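/- **Model.** A platform sells products $1,\dots,n$ ($n\ge 1$). Product $i$ has price $r_i\ge 0$, initial inventory $c_i\in\mathbb{Z}_{+}$ and usage duration $d_i\in\mathbb{Z}_{\ge 1}$: a unit sold in period $t$ returns at the beginning of period $t+d_i$. The collection $\mathcal S\subseteq 2^{[n]}$ of feasible assortments is nonempty and closed under subsets. At the beginning of each period $t=1,\dots,T$ an adversary reveals numbers $\xi_{i,t}\in\mathbb{Z}_{\ge 0}$ of new units of each product, which are added to the inventory, and a choice model $\phi_t$, where $\phi_t(S,i)\ge 0$ is the probability that product $i$ is bought when $S\in\mathcal S$ is offered, $\sum_i\phi_t(S,i)\le 1$, $\phi_t(S,i)=0$ for $i\notin S$, and $\phi_t(S\cup\{j\},i)\le\phi_t(S,i)$ whenever $j\ne i$ and $S,S\cup\{j\}\in\mathcal S$. Then an assortment $S_t\in\mathcal S$ of products with an available unit is offered, and the consumer buys at most one unit according to $\phi_t(S_t,\cdot)$. The clairvoyant optimum of a sequence $(\phi_t,\xi_t)_{t\le T}$ is the largest expected revenue of a policy that knows the whole sequence in advance but sees the realized choices only as they occur. An online algorithm is $\alpha$-competitive if, for every $T\ge 1$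 and every sequence, its expected revenue is at least $\alpha$ times the clairvoyant optimum. **Algorithm.** Batched Inventory Balancing (BIB) with penalty function $\Psi:[0,1]\to[0,1]$ and batch-size threshold $\gamma\in\mathbb{N}$ groups the units of each product $i$ into batches. Batch $1$ consists of the $c_i$ initial units and is ready. Units added by the adversary go one by one to the current charging batch; when that batch has $\gamma$ units it becomes ready and a new empty charging batch is opened. Returning units go back to their own batch. Let $f_{i,j,t}$ be the fraction of the units of ready batch $j$ of product $i$ that are not in use in period $t$. In period $t$, after the new units are assigned, BIB offers an $S_t\in\mathcal S$ that maximizes $\sum_{i} r_i\,\Psi(\max_j f_{i,j,t})\,\phi_t(S,i)$ over $S\in\mathcal S$ (maximum over the ready batches $j$ of product $i$) and has the smallest cardinality among the maximizers; if product $i$ is bought, a unit of a ready batch $j$ maximizing $f_{i,j,t}$ is allocated. Remaining ties are broken arbitrarily. **Theorem.** Let $\Psi:[0,1]\to[0,1]$ be non-decreasing, concave and differentiable with $\Psi(0)=0$ and $\Psi(1)=1$, let $c_0=\min_i c_i$, and let $\gamma$ be an integer with $1\le\gamma\le c_0$. Then BIB offers only products that have an available unit, and it is $\Gamma$-competitive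 with $\Gamma=\min\{\Gamma_1,\Gamma_2\}$, where $$\Gamma_1=\min_{x\in[0,1-\frac1{c_0}]}\frac{1-x}{\frac1{c_0}+\left(1+\frac{\gamma}{c_0}\right)(1-\Psi(x))+\int_{x+\frac1{c_0}}^1\Psi(y)\,dy},$$ $$\Gamma_2=\min_{x\in[0,1-\frac1\gamma]}\frac{1-x}{\frac1\gamma+1-\Psi(x)+\int_{x+\frac1\gamma}^1\Psi(y)\,dy}.$$ The same holds against adaptive adversaries, who may choose $(\phi_t,\xi_t)$ depending on the past choices: the expected revenue of BIB is at least $\Gamma$ times the expected clairvoyant optimum of the sequence $(\phi_t,\xi_t)_{t\le T}$ that the adversary produces. -/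

import Mathlib

open Set

/-- The data that do not change over time: prices, initial inventories, (deterministic, discrete)
usage durations, and the downward-closed collection of feasible assortments of `n` products.
A product that never returns within a horizon of `T` periods is one whose duration is at
least `T`. -/
structure Market (n : ℕ) where
  price : Fin n → ℝ
  price_nonneg : ∀ i, 0 ≤ price i
  initial : Fin n → ℕ
  duration : Fin n → ℕ
  duration_pos : ∀ i, 1 ≤ duration i
  feasible : Set (Finset (Fin n))
  feasible_nonempty : feasible.Nonempty
  down_closed : ∀ S ∈ feasible, ∀ S' ⊆ S, S' ∈ feasible

/-- What the adversary reveals at the beginning of a period: the choice model `φ(S, i)` of the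
arriving consumer and the numbers of units added by the exogenous shocks. -/
structure Arrival (n : ℕ) where
  choice : Finset (Fin n) → Fin n → ℝ
  shock : Fin n → ℕ

/-- The choice model is a (sub-)probability on the offered products, for every feasible
assortment, and it satisfies weak substitutability. -/
structure Arrival.IsValid {n : ℕ} (M : Market n) (a : Arrival n) : Prop where
  nonneg : ∀ S ∈ M.feasible, ∀ i, 0 ≤ a.choice S i
  sum_le_one : ∀ S ∈ M.feasible, ∑ i, a.choice S i ≤ 1
  eq_zero : ∀ S ∈ M.feasible, ∀ i, i ∉ S → a.choice S i = 0
  weak_substitutability : ∀ S ∈ M.feasible, ∀ i j, j ≠ i → insert j S ∈ M.feasible →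
    a.choice (insert j S) i ≤ a.choice S i

/-- The choices made by the past consumers, the most recent one first (`none`: nothing was
bought). Hence the period that follows the history `h` is number `h.length`, counting from 0. -/
abbrev History (n : ℕ) := List (Option (Fin n))

/-- An adaptive adversary: the next arrival may depend on all past choices. (The assortments
offered in the past by a given algorithm are functions of the past choices.) -/
abbrev Adversary (n : ℕ) := History n → Arrival n

/-- An oblivious adversary: a sequence of arrivals fixed in advance. -/
def oblivious {n : ℕ} (a : ℕ → Arrival n) : Adversary n := fun h => a h.length

/-- The arrivals of the completed periods, the most recent one first. -/
def pastArrivals {n : ℕ} (adv : Adversary n) : History n → List (Arrival n)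
  | [] => []
  | _ :: h => adv h :: pastArrivals adv h

/-- The arrivals known when the assortment of the period after `h` is chosen, the current one
included, the most recent one first. -/
def seenArrivals {n : ℕ} (adv : Adversary n) (h : History n) : List (Arrival n) :=
  adv h :: pastArrivals adv h

/-- The sequence of arrivals produced by the adversary along the history `h`:
`h.drop (h.length - t)` consists of the first `t` choices. -/
def realized {n : ℕ} (adv : Adversary n) (h : History n) : ℕ → Arrival n :=
  fun t => adv (h.drop (h.length - t))

/-- A policy, for a given adversary: the assortment offered after each history. -/
abbrev Policy (n : ℕ) := History n → Finset (Fin n)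

/-- An online algorithm sees the arrivals so far, the current one included, and the past choices
(both the most recent one first). -/
abbrev OnlineAlgorithm (n : ℕ) := List (Arrival n) → History n → Finset (Fin n)

/-- The policy that results from running an online algorithm against an adversary. -/
def OnlineAlgorithm.run {n : ℕ} (A : OnlineAlgorithm n) (adv : Adversary n) : Policy n :=
  fun h => A (seenArrivals adv h) h

/-- The probability of each outcome of a choice when `S` is offered. -/
def choiceProb {n : ℕ} (φ : Finset (Fin n) → Fin n → ℝ) (S : Finset (Fin n)) :
    Option (Fin n) → ℝ
  | some i => φ S i
  | none => 1 - ∑ i, φ S i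

/-- The expectation of `F` (history at the end), when `k` further periods follow the given
history and the assortments are chosen by `π`. -/
def expectation {n : ℕ} (adv : Adversary n) (π : Policy n) (F : History n → ℝ) :
    ℕ → History n → ℝ
  | 0, h => F h
  | k + 1, h => ∑ o : Option (Fin n),
      choiceProb (adv h).choice (π h) o * expectation adv π F k (o :: h)

/-- The revenue collected along a history. -/
def revenue {n : ℕ} (M : Market n) (h : History n) : ℝ :=
  (h.map fun o => o.elim 0 M.price).sum

/-- The expected revenue over the horizon of `T` periods. -/
def expectedRevenue {n : ℕ} (M : Market n) (adv : Adversary n) (π : Policy n) (T : ℕ) : ℝ :=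
  expectation adv π (revenue M) T []

/-- The number of units of product `i` in use in the period after `h`: a unit sold in period `t'`
is in use in the later periods `t < t' + d_i`, so these are the sales of the last `d_i - 1`
periods. -/
def inUse {n : ℕ} (M : Market n) (h : History n) (i : Fin n) : ℕ :=
  (h.take (M.duration i - 1)).count (some i)

/-- The number of units of product `i` that entered the system so far. -/
def supply {n : ℕ} (M : Market n) (as : List (Arrival n)) (i : Fin n) : ℕ :=
  M.initial i + (as.map fun a => a.shock i).sum

/-- The histories that can occur under `π`. -/
def Reachable {n : ℕ} (π : Policy n) : History n → Prop
  | [] => True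
  | o :: h => Reachable π h ∧ ∀ i, o = some i → i ∈ π h

/-- The policy only offers feasible assortments of products that have an available unit. -/
def Admissible {n : ℕ} (M : Market n) (adv : Adversary n) (π : Policy n) : Prop :=
  ∀ h, Reachable π h → π h ∈ M.feasible ∧
    ∀ i ∈ π h, inUse M h i < supply M (seenArrivals adv h) i

/-- The clairvoyant optimum: the largest expected revenue of a policy that is designed with full
knowledge of the sequence of choice models and shocks, but observes the realized choices only as
they happen. (Randomizing over policies does not change the supremum.) -/
noncomputable def clairvoyantOptimum {n : ℕ} (M : Market n) (a : ℕ → Arrival n) (T : ℕ) : ℝ :=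
  sSup {v | ∃ π : Policy n, Admissible M (oblivious a) π ∧
    v = expectedRevenue M (oblivious a) π T}

/-- The online algorithm never offers a product that it cannot deliver. -/
def OnlineAlgorithm.IsAdmissible {n : ℕ} (M : Market n) (A : OnlineAlgorithm n) : Prop :=
  ∀ adv : Adversary n, (∀ h, (adv h).IsValid M) → Admissible M adv (A.run adv)

/-- `A` is `α`-competitive against the clairvoyant optimum, for all horizons and all sequences of
choice models and exogenous shocks. -/
def OnlineAlgorithm.IsCompetitive {n : ℕ} (M : Market n) (A : OnlineAlgorithm n) (α : ℝ) : Prop :=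
  ∀ T : ℕ, 1 ≤ T → ∀ a : ℕ → Arrival n, (∀ t, (a t).IsValid M) →
    α * clairvoyantOptimum M a T ≤ expectedRevenue M (oblivious a) (A.run (oblivious a)) T

/-- `A` is `α`-competitive against adaptive adversaries: its expected revenue is compared with the
expected clairvoyant optimum of the sequence that the adversary has produced. -/
def OnlineAlgorithm.IsAdaptivelyCompetitive {n : ℕ} (M : Market n) (A : OnlineAlgorithm n)
    (α : ℝ) : Prop :=
  ∀ T : ℕ, 1 ≤ T → ∀ adv : Adversary n, (∀ h, (adv h).IsValid M) →
    α * expectation adv (A.run adv) (fun h => clairvoyantOptimum M (realized adv h) T) T [] ≤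
      expectedRevenue M adv (A.run adv) T

/-- The output of the offline assortment oracle for the rewards `R`: a feasible assortment of
maximal expected reward and, among those, of minimal cardinality. -/
def IsOracleOutput {n : ℕ} (M : Market n) (φ : Finset (Fin n) → Fin n → ℝ) (R : Fin n → ℝ)
    (S : Finset (Fin n)) : Prop :=
  S ∈ M.feasible ∧
  (∀ S' ∈ M.feasible, ∑ i, R i * φ S' i ≤ ∑ i, R i * φ S i) ∧
  (∀ S' ∈ M.feasible, ∑ i, R i * φ S' i = ∑ i, R i * φ S i → S.card ≤ S'.card)

/-- One new unit goes to the charging batch. The state is the number of ready batches and the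
size of the charging batch; the latter becomes ready when its size reaches `γ`. -/
def addUnit (γ : ℕ) (s : ℕ × ℕ) : ℕ × ℕ :=
  if s.2 + 1 = γ then (s.1 + 1, 0) else (s.1, s.2 + 1)

/-- The number of ready batches of a product after `N` units were added by exogenous shocks. At
the start there is one, which holds the initial units. -/
def readyCount (γ N : ℕ) : ℕ := ((addUnit γ)^[N] (1, 0)).1

theorem one_le_readyCount (γ N : ℕ) : 1 ≤ readyCount γ N := by
  unfold readyCount
  induction N with
  | zero => simp
  | succ N ih =>
    rw [Function.iterate_succ_apply']
    have h : ∀ s : ℕ × ℕ, s.1 ≤ (addUnit γ s).1 := by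
      intro s
      unfold addUnit
      split_ifs <;> simp
    exact ih.trans (h _)

/-- The indices of the ready batches of product `i`, given the arrivals so far. -/
def readyBatches {n : ℕ} (γ : ℕ) (as : List (Arrival n)) (i : Fin n) : Finset ℕ :=
  Finset.Icc 1 (readyCount γ (as.map fun a => a.shock i).sum)

theorem readyBatches_nonempty {n : ℕ} (γ : ℕ) (as : List (Arrival n)) (i : Fin n) :
    (readyBatches γ as i).Nonempty :=
  Finset.nonempty_Icc.2 (one_le_readyCount _ _)

/-- The size of the ready batch number `j` of product `i`. -/
def batchSize {n : ℕ} (M : Market n) (γ : ℕ) (i : Fin n) (j : ℕ) : ℕ :=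
  if j = 1 then M.initial i else γ

/-- A rule that says, given the arrivals so far and the past choices, from which batch of product
`i` a unit is allocated if the current consumer chooses `i`. -/
abbrev BatchRule (n : ℕ) := List (Arrival n) → History n → Fin n → ℕ

/-- The past sales together with the batches from which the units were allocated, the most recent
one first. The two lists are the arrivals of the completed periods and the choices made in them. -/
def saleLog {n : ℕ} (pick : BatchRule n) :
    List (Arrival n) → History n → List (Option (Fin n × ℕ))
  | a :: as, o :: h => (o.map fun i => (i, pick (a :: as) h i)) :: saleLog pick as h
  | _, _ => []

/-- The normalized inventory level of batch `j` of product `i`: the fraction of its units that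
are not in use, see `inUse`. -/
noncomputable def level {n : ℕ} (M : Market n) (γ : ℕ) (log : List (Option (Fin n × ℕ)))
    (i : Fin n) (j : ℕ) : ℝ :=
  1 - ((log.take (M.duration i - 1)).count (some (i, j)) : ℝ) / (batchSize M γ i j : ℝ)

/-- `A` is the Batched Inventory Balancing algorithm with penalty function `Ψ` and batch-size
threshold `γ`, with an arbitrary rule to break the ties that the oracle and the choice of a fullest
ready batch leave. Here `a` is the current arrival, and `as`, `h` are the arrivals and choices of
the completed periods. -/
def OnlineAlgorithm.IsBIB {n : ℕ} (M : Market n) (Ψ : ℝ → ℝ) (γ : ℕ) (A : OnlineAlgorithm n) :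
    Prop :=
  ∃ pick : BatchRule n, ∀ (a : Arrival n) (as : List (Arrival n)) (h : History n),
    (∀ b ∈ a :: as, b.IsValid M) → as.length = h.length →
    IsOracleOutput M a.choice
      (fun i => M.price i * Ψ ((readyBatches γ (a :: as) i).sup'
        (readyBatches_nonempty γ (a :: as) i) (level M γ (saleLog pick as h) i)))
      (A (a :: as) h) ∧
    ∀ i ∈ A (a :: as) h, pick (a :: as) h i ∈ readyBatches γ (a :: as) i ∧
      ∀ j ∈ readyBatches γ (a :: as) i,
        level M γ (saleLog pick as h) i j ≤ level M γ (saleLog pick as h) i (pick (a :: as) h i)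

/-- The smallest initial inventory. -/
def Market.minInitial {n : ℕ} [NeZero n] (M : Market n) : ℕ :=
  Finset.univ.inf' Finset.univ_nonempty M.initial

noncomputable def Gamma₁ (Ψ : ℝ → ℝ) (γ c₀ : ℝ) : ℝ :=
  sInf ((fun x : ℝ => (1 - x) /
    (1 / c₀ + (1 + γ / c₀) * (1 - Ψ x) + ∫ y in (x + 1 / c₀)..1, Ψ y)) '' Icc 0 (1 - 1 / c₀))

noncomputable def Gamma₂ (Ψ : ℝ → ℝ) (γ : ℝ) : ℝ :=
  sInf ((fun x : ℝ => (1 - x) /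
    (1 / γ + 1 - Ψ x + ∫ y in (x + 1 / γ)..1, Ψ y)) '' Icc 0 (1 - 1 / γ))

/-! Fix a history `h` of the algorithm and an admissible policy `π'` for the arrivals realized along
`h`. Let Ψ(t, i) be the penalty value of the fullest ready batch of product i at time t of `h`.
Every sale of i at time t by `π'` has price r_i, which splits into r_i Ψ(t, i) and r_i (1 - Ψ(t,
i)).

The first part is controlled by the oracle. The penalty values are frozen by `h`, so whatever `π'`
has seen, its expected penalized sale at time t is at most the oracle value at time t. That value is
also the conditional expected penalized price of the algorithm's own sale.

The second part is controlled pathwise, for every pair of histories of the two policies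
(`IsBIBRun.payment`): for each product, Γ times the sum of 1 - Ψ over the sales of `π'` is at most
the sum of 1 - Γ Ψ over the sales of the algorithm. Adding the parts and averaging over `h` cancels
the penalized prices against the oracle values and leaves Γ E[OPT] ≤ E[revenue]
(`IsBIBRun.competitive`). Since `h` is fixed before `π'` is considered, adaptive adversaries cost
nothing extra.

For the payment, the sales of `π'` are distributed over physical units, and each unit is attached to
a batch that is ready when the unit is used. The units of an unfinished charging batch are attached
to batch 1, which therefore carries c_i + γ units; this is the source of 1 + γ/c₀ in `Gamma₁`. Two
uses of one unit are at least d apart, so the sales of the batch in use at these times form disjoint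
sets. If k sales are in use, their residuals 1 - Γ Ψ sum to at least those of the levels 1 - l/c for
l < k (`chain_bound`). The bounds `Gamma₁` and `Gamma₂` make this pay for Γ (1 - Ψ(1 - k/c)) once
per attached unit (`batch_ratio`). -/

/-! ### Combinatorics: units, batches and charging -/

/-- Sales at the times in `U`, with durations `d`, can be served by units whose number at time `t`
is `cap t` if at each sale fewer than `cap t` units are in use. -/
theorem exists_unit_assignment (d : ℕ) (cap : ℕ → ℕ) (U : Finset ℕ)
    (hU : ∀ t ∈ U, (U.filter fun s => s < t ∧ t < s + d).card < cap t) :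
    ∃ σ : ℕ → ℕ, (∀ t ∈ U, σ t < cap t) ∧
      ∀ s ∈ U, ∀ t ∈ U, s < t → t < s + d → σ s ≠ σ t := by
  induction U using Finset.induction_on_max with
  | empty => exact ⟨id, by simp, by simp⟩
  | insert a U ha ih =>
    obtain ⟨σ, h1, h2⟩ := ih fun t ht => (Finset.card_le_card
      (Finset.filter_subset_filter _ (Finset.subset_insert a U))).trans_lt
        (hU t (Finset.mem_insert_of_mem ht))
    have hcard : ((U.filter fun s => s < a ∧ a < s + d).image σ).card
        < (Finset.range (cap a)).card := by
      rw [Finset.card_range]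
      exact Finset.card_image_le.trans_lt ((Finset.card_le_card
        (Finset.filter_subset_filter _ (Finset.subset_insert a U))).trans_lt
          (hU a (Finset.mem_insert_self a U)))
    -- Greedy colouring in time order: the latest sale takes a number below its own cap that no sale
    -- still in use holds. Hence `cap` need not be monotone.
    obtain ⟨x, hx, hx'⟩ := Finset.exists_mem_notMem_of_card_lt_card hcard
    have hne : ∀ t ∈ U, t ≠ a := fun t ht => (ha t ht).ne
    refine ⟨Function.update σ a x, ?_, ?_⟩
    · intro t ht
      rcases Finset.mem_insert.1 ht with rfl | ht
      · simpa using hx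
      · simpa [Function.update_of_ne (hne t ht)] using h1 t ht
    · intro s hs t ht hst hd
      rcases Finset.mem_insert.1 ht with rfl | ht
      · have hs' : s ∈ U := (Finset.mem_insert.1 hs).resolve_left hst.ne
        rw [Function.update_of_ne (hne s hs'), Function.update_self]
        rintro rfl
        exact hx' (Finset.mem_image_of_mem σ (Finset.mem_filter.2 ⟨hs', hst, hd⟩))
      · have hs' : s ∈ U := (Finset.mem_insert.1 hs).resolve_left (hst.trans (ha t ht)).ne
        rw [Function.update_of_ne (hne s hs'), Function.update_of_ne (hne t ht)]
        exact h2 s hs' t ht hst hd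

/-- If every `s ∈ W` has at most `n s` predecessors in `W`, then a monotone function sums over the
values `n s` to at least its sum over the ranks. -/
theorem sum_range_card_le_sum (φ : ℕ → ℝ) (N : ℕ) (hφ : ∀ k l, k ≤ l → l ≤ N → φ k ≤ φ l)
    (n : ℕ → ℕ) (W : Finset ℕ) (hN : ∀ s ∈ W, n s ≤ N)
    (hn : ∀ s ∈ W, (W.filter fun r => r < s).card ≤ n s) :
    ∑ l ∈ Finset.range W.card, φ l ≤ ∑ s ∈ W, φ (n s) := by
  induction W using Finset.induction_on_max with
  | empty => simp
  | insert a W ha ih =>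
    have haW : a ∉ W := fun h => lt_irrefl a (ha a h)
    rw [Finset.card_insert_of_notMem haW, Finset.sum_range_succ, Finset.sum_insert haW, add_comm]
    refine add_le_add (hφ _ _ ?_ (hN a (Finset.mem_insert_self a W))) (ih
      (fun s hs => hN s (Finset.mem_insert_of_mem hs))
      (fun s hs => (Finset.card_le_card
        (Finset.filter_subset_filter _ (Finset.subset_insert a W))).trans
          (hn s (Finset.mem_insert_of_mem hs))))
    refine le_trans (Finset.card_le_card ?_) (hn a (Finset.mem_insert_self a W))
    intro s hs
    exact Finset.mem_filter.2 ⟨Finset.mem_insert_of_mem hs, ha s hs⟩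

/-- The number of sales at the times in `L` that are in use at time `t`, with durations `d`. -/
def active (d : ℕ) (L : Finset ℕ) (t : ℕ) : ℕ := (L.filter fun s => s < t ∧ t < s + d).card

/-- Sales that a single unit can serve are paid for by the sales of a batch: `g k` is the value of
the penalty function when `k` units of the batch are in use. -/
theorem chain_bound (d N : ℕ) (L V : Finset ℕ) (Γ K : ℝ) (hΓ : 0 ≤ Γ) (hΓ1 : Γ ≤ 1) (g : ℕ → ℝ)
    (hg : ∀ k l, k ≤ l → l ≤ N → g l ≤ g k) (hg1 : ∀ k, k ≤ N → g k ≤ 1)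
    (hK : ∀ k, k ≤ N → Γ * K * (1 - g k) ≤ ∑ l ∈ Finset.range k, (1 - Γ * g l))
    (hN : ∀ t, active d L t ≤ N)
    (hV : ∀ s ∈ V, ∀ t ∈ V, s < t → s + d ≤ t) :
    Γ * K * ∑ v ∈ V, (1 - g (active d L v)) ≤ ∑ s ∈ L, (1 - Γ * g (active d L s)) := by
  have hnonneg : ∀ s, 0 ≤ 1 - Γ * g (active d L s) := fun s => by
    nlinarith [hg1 _ (hN s)]
  -- A sale lasts for d periods, so it cannot be in use at two times of `V`, which are at least d
  -- apart.
  have hdisj : (V : Set ℕ).PairwiseDisjoint fun v => L.filter fun s => s < v ∧ v < s + d := by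
    intro v hv w hw hvw
    refine Finset.disjoint_left.2 fun s h1 h2 => ?_
    simp only [Finset.mem_filter] at h1 h2
    rcases lt_or_gt_of_ne hvw with h | h
    · have := hV v hv w hw h
      omega
    · have := hV w hw v hv h
      omega
  calc Γ * K * ∑ v ∈ V, (1 - g (active d L v))
      = ∑ v ∈ V, Γ * K * (1 - g (active d L v)) := Finset.mul_sum ..
    _ ≤ ∑ v ∈ V, ∑ s ∈ L.filter (fun s => s < v ∧ v < s + d), (1 - Γ * g (active d L s)) := by
        refine Finset.sum_le_sum fun v _ => (hK _ (hN v)).trans ?_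
        -- If r < s are both in use at v, then r is in use at s, because r < s < v < r + d. So the
        -- rank of s among these sales is at most `active d L s`, and the residual 1 - Γ g is
        -- monotone.
        refine sum_range_card_le_sum (fun l => 1 - Γ * g l) N (fun k l hkl hl => ?_)
          (active d L) _ (fun s _ => hN s) (fun s hs => Finset.card_le_card fun r hr => ?_)
        · have := mul_le_mul_of_nonneg_left (hg k l hkl hl) hΓ
          linarith
        · simp only [Finset.mem_filter] at hr hs ⊢
          exact ⟨hr.1.1, hr.2, by omega⟩
    _ = ∑ s ∈ V.biUnion (fun v => L.filter fun s => s < v ∧ v < s + d),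
          (1 - Γ * g (active d L s)) := (Finset.sum_biUnion hdisj).symm
    _ ≤ ∑ s ∈ L, (1 - Γ * g (active d L s)) := by
        refine Finset.sum_le_sum_of_subset_of_nonneg ?_ fun s _ _ => hnonneg s
        exact Finset.biUnion_subset.2 fun v _ => Finset.filter_subset _ _

/-- The batch to which a unit is attached, when `K` units are attached to batch `1` and `γ` units
to each later one. -/
def unitBatch (K γ u : ℕ) : ℕ := if u < K then 1 else (u - K) / γ + 2

/-- This bounds how many units share the residual sum of one batch, each of them receiving an equal
part. -/
theorem card_unitBatch_fiber_le (K γ j B : ℕ) (hγ : 1 ≤ γ) :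
    ((Finset.range B).filter fun u => unitBatch K γ u = j).card ≤ if j = 1 then K else γ := by
  split_ifs with hj
  · refine (Finset.card_le_card (t := Finset.range K) fun u hu => ?_).trans_eq
      (Finset.card_range K)
    have hu2 : unitBatch K γ u = j := (Finset.mem_filter.1 hu).2
    unfold unitBatch at hu2
    split_ifs at hu2 with h
    · exact Finset.mem_range.2 h
    · rw [hj] at hu2
      exact absurd hu2 (by simp)
  · refine (Finset.card_le_card
      (t := Finset.Ico (K + (j - 2) * γ) (K + (j - 2) * γ + γ)) fun u hu => ?_).trans_eq (by simp)
    have hu2 : unitBatch K γ u = j := (Finset.mem_filter.1 hu).2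
    unfold unitBatch at hu2
    split_ifs at hu2 with h
    · exact absurd hu2.symm hj
    · have h1 : j - 2 = (u - K) / γ := by rw [← hu2, Nat.add_sub_cancel]
      have h2 := Nat.div_add_mod (u - K) γ
      have h3 := Nat.mod_lt (u - K) (show γ > 0 from hγ)
      rw [Finset.mem_Ico, h1, mul_comm]
      omega

/-- Units are numbered batch by batch, so a bound on the number of a unit bounds the index of its
batch. -/
theorem unitBatch_mem (K γ u m : ℕ) (hγ : 1 ≤ γ) (hm : 1 ≤ m) (hu : u < K + γ * (m - 1)) :
    unitBatch K γ u ∈ Finset.Icc 1 m := by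
  rw [Finset.mem_Icc, unitBatch]
  split_ifs with h
  · omega
  · have : (u - K) / γ < m - 1 := (Nat.div_lt_iff_lt_mul hγ).2 (by rw [mul_comm]; omega)
    exact ⟨Nat.le_add_left 1 _, by omega⟩

/-- The sales of one product in any schedule, weighted by `1 - w t`, are paid for by the sales from
the batches, if `w t` dominates the penalty values of the ready batches `1, …, m t`. -/
theorem product_bound (d K γ J : ℕ) (U : Finset ℕ) (L : ℕ → Finset ℕ) (size m : ℕ → ℕ)
    (hγ : 1 ≤ γ) (Γ : ℝ) (hΓ : 0 ≤ Γ) (hΓ1 : Γ ≤ 1) (g : ℕ → ℕ → ℝ) (w : ℕ → ℝ)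
    (hg : ∀ j k l, k ≤ l → l ≤ size j → g j l ≤ g j k) (hg1 : ∀ j k, k ≤ size j → g j k ≤ 1)
    (hK : ∀ j k, k ≤ size j → Γ * ((if j = 1 then K else γ : ℕ) : ℝ) * (1 - g j k) ≤
      ∑ l ∈ Finset.range k, (1 - Γ * g j l))
    (hN : ∀ j t, active d (L j) t ≤ size j)
    (hm : ∀ t ∈ U, 1 ≤ m t) (hJ : ∀ t ∈ U, m t ≤ J)
    (hU : ∀ t ∈ U, active d U t < K + γ * (m t - 1))
    (hw : ∀ t ∈ U, ∀ j ∈ Finset.Icc 1 (m t), g j (active d (L j) t) ≤ w t) :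
    Γ * ∑ t ∈ U, (1 - w t) ≤
      ∑ j ∈ Finset.Icc 1 J, ∑ s ∈ L j, (1 - Γ * g j (active d (L j) s)) := by
  obtain ⟨σ, hσ, hσ'⟩ := exists_unit_assignment d _ U hU
  set b : ℕ → ℕ := fun t => unitBatch K γ (σ t) with hb
  -- The unit serving a sale at t belongs to a batch that is ready at t, which is where `w t`
  -- dominates the penalty value.
  have hbm : ∀ t ∈ U, b t ∈ Finset.Icc 1 (m t) := fun t ht =>
    unitBatch_mem K γ _ _ hγ (hm t ht) (hσ t ht)
  set B := K + γ * (J - 1)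
  have hσB : ∀ t ∈ U, σ t ∈ Finset.range B := fun t ht => Finset.mem_range.2
    ((hσ t ht).trans_le (Nat.add_le_add_left (Nat.mul_le_mul_left γ (Nat.sub_le_sub_right (hJ t ht) 1)) K))
  have hunitJ : ∀ t ∈ U, b t ∈ Finset.Icc 1 J := fun t ht => by
    have h1 := Finset.mem_Icc.1 (hbm t ht)
    exact Finset.mem_Icc.2 ⟨h1.1, h1.2.trans (hJ t ht)⟩
  have hnonneg : ∀ j, 0 ≤ ∑ s ∈ L j, (1 - Γ * g j (active d (L j) s)) := fun j =>
    Finset.sum_nonneg fun s _ => by nlinarith [hg1 j _ (hN j s)]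
  calc Γ * ∑ t ∈ U, (1 - w t)
      ≤ Γ * ∑ t ∈ U, (1 - g (b t) (active d (L (b t)) t)) := by
        refine mul_le_mul_of_nonneg_left (Finset.sum_le_sum fun t ht => ?_) hΓ
        have := hw t ht _ (hbm t ht)
        linarith
    _ = ∑ j ∈ Finset.Icc 1 J, ∑ t ∈ U with b t = j, Γ * (1 - g j (active d (L j) t)) := by
        rw [Finset.mul_sum, ← Finset.sum_fiberwise_of_maps_to hunitJ]
        refine Finset.sum_congr rfl fun j _ => Finset.sum_congr rfl fun t ht => ?_
        rw [(Finset.mem_filter.1 ht).2]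
    _ ≤ _ := Finset.sum_le_sum fun j hj => ?_
  set F : Finset ℕ := (Finset.range B).filter fun u => unitBatch K γ u = j with hF
  set X := ∑ s ∈ L j, (1 - Γ * g j (active d (L j) s)) with hX
  set κ : ℕ := if j = 1 then K else γ with hκ
  have hFc : F.card ≤ κ := card_unitBatch_fiber_le K γ j B hγ
  have hmaps : ∀ t ∈ U.filter (fun t => b t = j), σ t ∈ F := fun t ht => by
    rw [Finset.mem_filter] at ht
    exact Finset.mem_filter.2 ⟨hσB t ht.1, ht.2⟩
  rw [← Finset.sum_fiberwise_of_maps_to hmaps]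
  -- `K` may be 0; then no unit is attached to batch 1 and the share X / κ is not needed.
  rcases Nat.eq_zero_or_pos κ with h0 | hpos
  · have : F = ∅ := Finset.card_eq_zero.1 (by omega)
    rw [this, Finset.sum_empty]
    exact hnonneg j
  have hκ0 : (0 : ℝ) < κ := by exact_mod_cast hpos
  have hchain : ∀ u ∈ F, ∑ t ∈ (U.filter fun t => b t = j) with σ t = u,
      Γ * (1 - g j (active d (L j) t)) ≤ X / κ := by
    intro u _
    rw [le_div_iff₀ hκ0, ← Finset.mul_sum]
    have := chain_bound d (size j) (L j) ((U.filter fun t => b t = j).filter fun t => σ t = u)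
      Γ κ hΓ hΓ1 (g j) (hg j) (hg1 j) (hK j) (hN j) ?_
    · linarith
    · intro s hs t ht hst
      simp only [Finset.mem_filter] at hs ht
      by_contra h
      exact hσ' s hs.1.1 t ht.1.1 hst (by omega) (hs.2.trans ht.2.symm)
  calc _ ≤ ∑ u ∈ F, X / κ := Finset.sum_le_sum hchain
    _ = F.card * (X / κ) := by rw [Finset.sum_const, nsmul_eq_mul]
    _ ≤ κ * (X / κ) := mul_le_mul_of_nonneg_right (by exact_mod_cast hFc)
        (div_nonneg (hnonneg j) hκ0.le)
    _ = X := mul_div_cancel₀ X hκ0.ne'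

/-! ### Analysis: the ratio inequality for batches -/

/-- The Riemann sum of a non-decreasing function over the levels of a batch of size `c`. -/
theorem sum_level_le (Ψ : ℝ → ℝ) (hmono : MonotoneOn Ψ (Icc 0 1)) (h1 : Ψ 1 = 1) (c k : ℕ)
    (hk : k + 1 ≤ c) :
    ∑ l ∈ Finset.range (k + 1), Ψ (1 - l / c) ≤ 1 + c * ∫ y in (1 - k / c : ℝ)..1, Ψ y := by
  have hc : (0 : ℝ) < c := by exact_mod_cast (show 0 < c by omega)
  have hkc : (k : ℝ) ≤ c := by exact_mod_cast (show k ≤ c by omega)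
  have hanti : AntitoneOn (fun y : ℝ => Ψ (1 - y / c)) (Icc 0 (0 + k)) := by
    have hmem : ∀ y ∈ Icc (0 : ℝ) (0 + k), 1 - y / c ∈ Icc (0 : ℝ) 1 := fun y hy => by
      have h2 : y / c ≤ 1 := (div_le_one hc).2 (by linarith [hy.2])
      have h3 : 0 ≤ y / c := div_nonneg hy.1 hc.le
      exact ⟨by linarith, by linarith⟩
    intro x hx y hy hxy
    exact hmono (hmem y hy) (hmem x hx) (by gcongr)
  have := hanti.sum_le_integral
  rw [intervalIntegral.integral_comp_sub_div (fun y => Ψ y) hc.ne'] at this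
  -- The integral covers the levels l = 1, …, k; the term l = 0, a full batch, is the summand 1.
  rw [Finset.sum_range_succ']
  simp only [zero_add, zero_div, sub_zero, smul_eq_mul, Nat.cast_zero, h1] at this ⊢
  linarith

/-- The ratio bound passes from batches of size `c₀` to all larger batches. -/
theorem ratio_of_le (Ψ : ℝ → ℝ) (hmono : MonotoneOn Ψ (Icc 0 1)) (hconc : ConcaveOn ℝ (Icc 0 1) Ψ)
    (h1 : Ψ 1 = 1) (Γ e c₀ c : ℝ) (hΓ : 0 ≤ Γ) (he : 0 ≤ e) (hc₀ : 1 ≤ c₀)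
    (hc : c₀ ≤ c)
    (hratio : ∀ x ∈ Icc (0 : ℝ) (1 - 1 / c₀),
      Γ * (1 / c₀ + (1 + e / c₀) * (1 - Ψ x) + ∫ y in (x + 1 / c₀)..1, Ψ y) ≤ 1 - x)
    (x : ℝ) (hx : x ∈ Icc (0 : ℝ) (1 - 1 / c)) :
    Γ * (1 / c + (1 + e / c) * (1 - Ψ x) + ∫ y in (x + 1 / c)..1, Ψ y) ≤ 1 - x := by
  have hc₀p : 0 < c₀ := by linarith
  have hcp : 0 < c := by linarith
  have hu : 1 / c ≤ 1 / c₀ := one_div_le_one_div_of_le hc₀p hc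
  have hup : 0 < 1 / c := by positivity
  have hu1 : 1 / c₀ ≤ 1 := (div_le_one hc₀p).2 hc₀
  have hle1 : ∀ y ∈ Icc (0 : ℝ) 1, Ψ y ≤ 1 := fun y hy =>
    h1 ▸ hmono hy (right_mem_Icc.2 zero_le_one) hy.2
  have hint : ∀ a b : ℝ, 0 ≤ a → a ≤ b → b ≤ 1 → IntervalIntegrable Ψ MeasureTheory.volume a b :=
    fun a b ha hab hb => MonotoneOn.intervalIntegrable (by
      rw [uIcc_of_le hab]
      exact hmono.mono (Icc_subset_Icc ha hb))
  have hIle : ∀ a b : ℝ, 0 ≤ a → a ≤ b → b ≤ 1 → ∫ y in a..b, Ψ y ≤ b - a := by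
    intro a b ha hab hb
    calc ∫ y in a..b, Ψ y ≤ ∫ _ in a..b, (1 : ℝ) :=
          intervalIntegral.integral_mono_on hab (hint a b ha hab hb) (by simp)
            fun y hy => hle1 y ⟨ha.trans hy.1, hy.2.trans hb⟩
      _ = b - a := by simp
  have hx1 : x ≤ 1 := by linarith [hx.2]
  have hΨx := hle1 x ⟨hx.1, hx1⟩
  have hec : e / c ≤ e / c₀ := by gcongr
  rcases le_or_gt x (1 - 1 / c₀) with h | h
  -- The integral gains at most 1/c₀ - 1/c when its lower limit drops to x + 1/c, which is what the
  -- first summand loses.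
  · refine le_trans (mul_le_mul_of_nonneg_left ?_ hΓ) (hratio x ⟨hx.1, h⟩)
    rw [← intervalIntegral.integral_add_adjacent_intervals
      (hint (x + 1 / c) (x + 1 / c₀) (by linarith [hx.1]) (by linarith) (by linarith))
      (hint (x + 1 / c₀) 1 (by linarith [hx.1]) (by linarith) le_rfl)]
    have h2 := hIle (x + 1 / c) (x + 1 / c₀) (by linarith [hx.1]) (by linarith) (by linarith)
    have h3 : (1 + e / c) * (1 - Ψ x) ≤ (1 + e / c₀) * (1 - Ψ x) :=
      mul_le_mul_of_nonneg_right (by linarith) (by linarith)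
    linarith
  -- Here x lies beyond the range of `hratio`. The bound at the endpoint 1 - 1/c₀, where the
  -- integral vanishes, is scaled by (1 - x) c₀; concavity makes 1 - Ψ x shrink at most
  -- proportionally to that factor.
  · have hz : (1 - 1 / c₀) ∈ Icc (0 : ℝ) 1 := ⟨by linarith, by linarith [one_div_pos.2 hc₀p]⟩
    have hr := hratio (1 - 1 / c₀) ⟨hz.1, le_rfl⟩
    rw [sub_add_cancel, intervalIntegral.integral_same, add_zero, sub_sub_cancel] at hr
    have h2 := hIle (x + 1 / c) 1 (by linarith [hx.1]) (by linarith [hx.2]) le_rfl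
    -- the slope of `Ψ` towards `1` is non-increasing
    have hslope : (1 - Ψ x) * (1 / c₀) ≤ (1 - Ψ (1 - 1 / c₀)) * (1 - x) := by
      set z := 1 - 1 / c₀ with hzdef
      have hz1 : 0 < 1 - z := by linarith [one_div_pos.2 hc₀p]
      have hcomb := hconc.2 hz (right_mem_Icc.2 zero_le_one)
        (show 0 ≤ (1 - x) / (1 - z) from div_nonneg (by linarith) hz1.le)
        (show 0 ≤ (x - z) / (1 - z) from div_nonneg (by linarith) hz1.le)
        (by field_simp; ring)
      have hpt : ((1 - x) / (1 - z)) • z + ((x - z) / (1 - z)) • (1 : ℝ) = x := by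
        simp only [smul_eq_mul]
        field_simp
        ring
      rw [hpt, h1] at hcomb
      simp only [smul_eq_mul, mul_one] at hcomb
      rw [div_mul_eq_mul_div, ← add_div, div_le_iff₀ hz1] at hcomb
      have : 1 / c₀ = 1 - z := by rw [hzdef]; ring
      rw [this]
      linarith
    have hA : (1 / c + (1 + e / c) * (1 - Ψ x) + ∫ y in (x + 1 / c)..1, Ψ y) * (1 / c₀) ≤
        (1 / c₀ + (1 + e / c₀) * (1 - Ψ (1 - 1 / c₀))) * (1 - x) := by
      have h3 : (1 / c + ∫ y in (x + 1 / c)..1, Ψ y) * (1 / c₀) ≤ (1 - x) * (1 / c₀) :=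
        mul_le_mul_of_nonneg_right (by linarith) (by positivity)
      have h4 : (1 + e / c) * ((1 - Ψ x) * (1 / c₀)) ≤
          (1 + e / c₀) * ((1 - Ψ (1 - 1 / c₀)) * (1 - x)) := by
        have h5 : 0 ≤ (1 - Ψ x) * (1 / c₀) := mul_nonneg (by linarith) (by positivity)
        exact mul_le_mul (by linarith) hslope h5 (by positivity)
      linarith
    have hB := mul_le_mul_of_nonneg_left hA hΓ
    have hC := mul_le_mul_of_nonneg_right hr (show 0 ≤ 1 - x by linarith)
    have hp : 0 < 1 / c₀ := by positivity
    refine le_of_mul_le_mul_right ?_ hp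
    linarith

/-- The inequality that makes the sales of a batch of size `c` pay for `c + e` units. -/
theorem batch_ratio (Ψ : ℝ → ℝ) (hmono : MonotoneOn Ψ (Icc 0 1))
    (hconc : ConcaveOn ℝ (Icc 0 1) Ψ)
    (h1 : Ψ 1 = 1) (Γ : ℝ) (e c₀ c : ℕ) (hΓ : 0 ≤ Γ) (hc₀ : 1 ≤ c₀)
    (hc : c₀ ≤ c)
    (hratio : ∀ x ∈ Icc (0 : ℝ) (1 - 1 / c₀),
      Γ * (1 / c₀ + (1 + e / c₀) * (1 - Ψ x) + ∫ y in (x + 1 / c₀)..1, Ψ y) ≤ 1 - x)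
    (k : ℕ) (hk : k ≤ c) :
    Γ * ((c + e : ℕ) : ℝ) * (1 - Ψ (1 - k / c)) ≤
      ∑ l ∈ Finset.range k, (1 - Γ * Ψ (1 - l / c)) := by
  rcases k with _ | k
  · simp [h1]
  have hcp : (0 : ℝ) < c := by exact_mod_cast (show 0 < c by omega)
  have hkc : ((k + 1 : ℕ) : ℝ) ≤ c := by exact_mod_cast hk
  -- With k + 1 units in use the level is x = 1 - (k + 1)/c. The integral starts one step higher, at
  -- 1 - k/c, as in the Riemann sum over l ≤ k.
  have hx : (1 - ((k + 1 : ℕ) : ℝ) / c) ∈ Icc (0 : ℝ) (1 - 1 / c) := by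
    constructor
    · have := (div_le_one hcp).2 hkc
      linarith
    · have : (1 : ℝ) ≤ ((k + 1 : ℕ) : ℝ) := by exact_mod_cast Nat.le_add_left 1 k
      gcongr
  have hr := ratio_of_le Ψ hmono hconc h1 Γ e c₀ c hΓ (Nat.cast_nonneg e)
    (by exact_mod_cast hc₀) (by exact_mod_cast hc) hratio _ hx
  have hs := mul_le_mul_of_nonneg_left (sum_level_le Ψ hmono h1 c k hk) hΓ
  have hlo : (1 - ((k + 1 : ℕ) : ℝ) / c) + 1 / c = 1 - k / c := by
    push_cast
    field_simp
    ring
  rw [hlo] at hr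
  set I := ∫ y in (1 - k / c : ℝ)..1, Ψ y
  set P := Ψ (1 - ((k + 1 : ℕ) : ℝ) / c)
  have hr' := mul_le_mul_of_nonneg_left hr hcp.le
  have e1 : (c : ℝ) * (Γ * (1 / c + (1 + e / c) * (1 - P) + I)) =
      Γ * ((c + e : ℕ) : ℝ) * (1 - P) + Γ * (1 + c * I) := by
    push_cast
    field_simp
    ring
  have e2 : (c : ℝ) * (1 - (1 - ((k + 1 : ℕ) : ℝ) / c)) = ((k + 1 : ℕ) : ℝ) := by
    field_simp
    ring
  rw [e1, e2] at hr'
  rw [Finset.sum_sub_distrib, ← Finset.mul_sum, Finset.sum_const, Finset.card_range, nsmul_eq_mul,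
    mul_one]
  linarith

/-- The infima defining the competitive ratio lie in `[0, 1]` and satisfy the ratio bound. -/
theorem sInf_ratio (Ψ : ℝ → ℝ) (hmono : MonotoneOn Ψ (Icc 0 1)) (h0 : Ψ 0 = 0) (h1 : Ψ 1 = 1)
    (e c : ℝ) (he : 0 ≤ e) (hc : 1 ≤ c) (G : ℝ)
    (hG : G = sInf ((fun x : ℝ => (1 - x) /
      (1 / c + (1 + e / c) * (1 - Ψ x) + ∫ y in (x + 1 / c)..1, Ψ y)) '' Icc 0 (1 - 1 / c))) :
    0 ≤ G ∧ G ≤ 1 ∧ ∀ Γ ≤ G, ∀ x ∈ Icc (0 : ℝ) (1 - 1 / c),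
      Γ * (1 / c + (1 + e / c) * (1 - Ψ x) + ∫ y in (x + 1 / c)..1, Ψ y) ≤ 1 - x := by
  have hcp : 0 < c := by linarith
  have hu : 0 < 1 / c := by positivity
  have hu1 : 1 / c ≤ 1 := (div_le_one hcp).2 hc
  have hle1 : ∀ y ∈ Icc (0 : ℝ) 1, Ψ y ≤ 1 := fun y hy =>
    h1 ▸ hmono hy (right_mem_Icc.2 zero_le_one) hy.2
  have hge0 : ∀ y ∈ Icc (0 : ℝ) 1, 0 ≤ Ψ y := fun y hy =>
    h0 ▸ hmono (left_mem_Icc.2 zero_le_one) hy hy.1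
  have hD : ∀ x ∈ Icc (0 : ℝ) (1 - 1 / c),
      1 / c ≤ 1 / c + (1 + e / c) * (1 - Ψ x) + ∫ y in (x + 1 / c)..1, Ψ y := fun x hx => by
    have h2 : 0 ≤ ∫ y in (x + 1 / c)..1, Ψ y :=
      intervalIntegral.integral_nonneg (by linarith [hx.2]) fun y hy =>
        hge0 y ⟨by linarith [hx.1, hy.1], hy.2⟩
    have h3 : 0 ≤ (1 + e / c) * (1 - Ψ x) :=
      mul_nonneg (by positivity) (by linarith [hle1 x ⟨hx.1, by linarith [hx.2]⟩])
    linarith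
  have hlb : ∀ v ∈ (fun x : ℝ => (1 - x) /
      (1 / c + (1 + e / c) * (1 - Ψ x) + ∫ y in (x + 1 / c)..1, Ψ y)) '' Icc 0 (1 - 1 / c),
      0 ≤ v := by
    rintro v ⟨x, hx, rfl⟩
    exact div_nonneg (by linarith [hx.2]) (hu.le.trans (hD x hx))
  have hbdd : BddBelow ((fun x : ℝ => (1 - x) /
      (1 / c + (1 + e / c) * (1 - Ψ x) + ∫ y in (x + 1 / c)..1, Ψ y)) '' Icc 0 (1 - 1 / c)) :=
    ⟨0, hlb⟩
  -- At the right endpoint the numerator is 1/c and the denominator is at least 1/c, so the infimum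
  -- is at most 1.
  have hend : (1 - 1 / c) ∈ Icc (0 : ℝ) (1 - 1 / c) := ⟨by linarith, le_rfl⟩
  refine ⟨hG ▸ Real.sInf_nonneg hlb, ?_, fun Γ hΓ x hx => ?_⟩
  · rw [hG]
    refine (csInf_le hbdd ⟨_, hend, rfl⟩).trans ?_
    have := hD _ hend
    exact (div_le_one (hu.trans_le this)).2 (by linarith)
  · have h2 := csInf_le hbdd ⟨x, hx, rfl⟩
    rw [← hG] at h2
    exact (le_div_iff₀ (hu.trans_le (hD x hx))).1 (hΓ.trans h2)

/-! ### Histories as sequences in forward time -/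

section Lists

variable {α : Type*}

/-- The first `t` entries of a list whose most recent entry comes first. -/
def firstEntries (l : List α) (t : ℕ) : List α := l.drop (l.length - t)

theorem firstEntries_length (l : List α) : firstEntries l l.length = l := by simp [firstEntries]

theorem length_firstEntries (l : List α) {t : ℕ} (ht : t ≤ l.length) :
    (firstEntries l t).length = t := by
  simp [firstEntries]
  omega

theorem firstEntries_cons (a : α) (l : List α) {t : ℕ} (ht : t ≤ l.length) :
    firstEntries (a :: l) t = firstEntries l t := by
  rw [firstEntries, List.length_cons, Nat.succ_sub ht, List.drop_succ_cons, firstEntries]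

/-- Entry number `t` of a list of choices whose most recent entry comes first. -/
def choiceAt (l : List (Option α)) (t : ℕ) : Option α := l.reverse.getD t none

theorem choiceAt_cons (o : Option α) (l : List (Option α)) {t : ℕ} (ht : t < l.length) :
    choiceAt (o :: l) t = choiceAt l t := by
  simp only [choiceAt, List.reverse_cons]
  rw [List.getD_append _ _ _ _ (by simpa using ht)]

theorem choiceAt_cons_length (o : Option α) (l : List (Option α)) :
    choiceAt (o :: l) l.length = o := by
  simp only [choiceAt, List.reverse_cons]
  rw [List.getD_append_right _ _ _ _ (by simp)]
  simp

/-- The sum of a weight over the entries of a list, where the weight of an entry may depend on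
the earlier entries. -/
def pathSum (w : Option α → List (Option α) → ℝ) (l : List (Option α)) : ℝ :=
  ∑ t ∈ Finset.range l.length, w (choiceAt l t) (firstEntries l t)

theorem pathSum_nil (w : Option α → List (Option α) → ℝ) : pathSum w [] = 0 := by simp [pathSum]

theorem pathSum_cons (w : Option α → List (Option α) → ℝ) (o : Option α) (l : List (Option α)) :
    pathSum w (o :: l) = pathSum w l + w o l := by
  rw [pathSum, List.length_cons, Finset.sum_range_succ, choiceAt_cons_length,
    firstEntries_cons o l le_rfl, firstEntries_length, pathSum]
  congr 1
  refine Finset.sum_congr rfl fun t ht => ?_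
  rw [Finset.mem_range] at ht
  rw [choiceAt_cons o l ht, firstEntries_cons o l ht.le]

variable [DecidableEq α]

/-- The times at which `x` was chosen. -/
def timesOf (l : List (Option α)) (x : α) : Finset ℕ :=
  (Finset.range l.length).filter fun t => choiceAt l t = some x

theorem mem_timesOf {l : List (Option α)} {x : α} {t : ℕ} :
    t ∈ timesOf l x ↔ t < l.length ∧ choiceAt l t = some x := by
  simp [timesOf]

theorem timesOf_cons (o : Option α) (l : List (Option α)) (x : α) :
    timesOf (o :: l) x = if o = some x then insert l.length (timesOf l x) else timesOf l x := by
  ext t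
  have key : t ∈ timesOf (o :: l) x ↔ (t = l.length ∧ o = some x) ∨ t ∈ timesOf l x := by
    rw [mem_timesOf, mem_timesOf, List.length_cons]
    rcases lt_trichotomy t l.length with h | h | h
    · rw [choiceAt_cons o l h]
      simp [h, h.ne, h.trans (Nat.lt_succ_self _)]
    · subst h
      rw [choiceAt_cons_length]
      simp
    · simp [h.ne', h.not_gt, show ¬ t < l.length + 1 by omega]
  rw [key]
  split_ifs with h <;> simp [h]

/-- The bridge from the model's count over the most recent k entries to sets of sale times. Any
lawful `BEq` is allowed, so the lemma fits the instance carried by the counts. -/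
theorem count_take_firstEntries [BEq (Option α)] [LawfulBEq (Option α)]
    (l : List (Option α)) (x : α) (k t : ℕ) (ht : t ≤ l.length) :
    ((firstEntries l t).take k).count (some x) =
      ((timesOf l x).filter fun s => s < t ∧ t ≤ s + k).card := by
  induction l generalizing k t with
  | nil => simp [firstEntries, timesOf]
  | cons o l ih =>
    rcases Nat.lt_or_eq_of_le ht with h | h
    · have h' : t ≤ l.length := by simpa [Nat.lt_succ_iff] using h
      rw [firstEntries_cons o l h', ih k t h', timesOf_cons]
      split_ifs with ho
      · rw [Finset.filter_insert, if_neg (by omega)]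
      · rfl
    · subst h
      rw [firstEntries_length, List.length_cons]
      have hlt : ∀ s ∈ timesOf l x, s < l.length := fun s hs => (mem_timesOf.1 hs).1
      rcases k with _ | k
      · rw [List.take_zero, List.count_nil]
        symm
        rw [Finset.card_eq_zero, Finset.filter_eq_empty_iff]
        intro s _
        omega
      · have ihk := ih k l.length le_rfl
        rw [firstEntries_length] at ihk
        rw [List.take_succ_cons, List.count_cons, ihk, timesOf_cons]
        have hf : ((timesOf l x).filter fun s => s < l.length ∧ l.length ≤ s + k) =
            (timesOf l x).filter fun s => s < l.length + 1 ∧ l.length + 1 ≤ s + (k + 1) := by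
          refine Finset.filter_congr fun s hs => ?_
          have := hlt s hs
          omega
        rw [hf]
        split_ifs with h1 h2 h2
        · rw [Finset.filter_insert, if_pos (by omega), Finset.card_insert_of_notMem]
          intro h3
          exact lt_irrefl _ (hlt _ (Finset.mem_filter.1 h3).1)
        · simp_all
        · simp_all
        · simp

theorem count_take_eq_active [BEq (Option α)] [LawfulBEq (Option α)] (l : List (Option α))
    (x : α) (d t : ℕ) (hd : 1 ≤ d)
    (ht : t ≤ l.length) :
    ((firstEntries l t).take (d - 1)).count (some x) = active d (timesOf l x) t := by
  rw [count_take_firstEntries l x _ t ht, active]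
  congr 1
  refine Finset.filter_congr fun s _ => ?_
  omega

theorem sum_range_elim [Fintype α] (v : α → ℕ → ℝ) (l : List (Option α)) :
    ∑ t ∈ Finset.range l.length, (choiceAt l t).elim 0 (fun i => v i t) =
      ∑ i, ∑ t ∈ timesOf l i, v i t := by
  simp only [timesOf, Finset.sum_filter]
  rw [Finset.sum_comm]
  refine Finset.sum_congr rfl fun t _ => ?_
  cases h : choiceAt l t <;> simp

end Lists

/-! ### Counting units and ready batches -/

theorem active_le_sum (d : ℕ) (U J : Finset ℕ) (L : ℕ → Finset ℕ) (hU : U ⊆ J.biUnion L) (t : ℕ) :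
    active d U t ≤ ∑ j ∈ J, active d (L j) t := by
  refine le_trans (Finset.card_le_card ?_) Finset.card_biUnion_le
  intro s hs
  obtain ⟨h1, h2⟩ := Finset.mem_filter.1 hs
  obtain ⟨j, hj, hsj⟩ := Finset.mem_biUnion.1 (hU h1)
  exact Finset.mem_biUnion.2 ⟨j, hj, Finset.mem_filter.2 ⟨hsj, h2⟩⟩

/-- The invariant of `addUnit` is that the charging batch holds N % γ units. -/
theorem readyCount_eq (γ N : ℕ) (hγ : 1 ≤ γ) : readyCount γ N = N / γ + 1 := by
  have h : ∀ N, (addUnit γ)^[N] (1, 0) = (N / γ + 1, N % γ) := by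
    intro N
    induction N with
    | zero => simp
    | succ N ih =>
      rw [Function.iterate_succ_apply', ih, addUnit]
      have h1 := Nat.div_add_mod N γ
      have h2 := Nat.mod_lt N (show γ > 0 from hγ)
      have key : (N + 1) / γ = (if N % γ + 1 = γ then N / γ + 1 else N / γ) ∧
          (N + 1) % γ = (if N % γ + 1 = γ then 0 else N % γ + 1) := by
        rw [Nat.div_mod_unique hγ]
        split_ifs with h3
        · exact ⟨by rw [Nat.mul_add]; omega, hγ⟩
        · exact ⟨by omega, by omega⟩
      simp only
      split_ifs with h3
      · rw [if_pos h3, if_pos h3] at key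
        rw [key.1, key.2]
      · rw [if_neg h3, if_neg h3] at key
        rw [key.1, key.2]
  rw [readyCount, h]

theorem readyCount_mono (γ : ℕ) (hγ : 1 ≤ γ) : Monotone (readyCount γ) := fun a b hab => by
  rw [readyCount_eq γ a hγ, readyCount_eq γ b hγ]
  exact Nat.succ_le_succ (Nat.div_le_div_right hab)

/-- The charging batch holds fewer than γ units, so one extra allotment of γ, the `+ 1` that batch 1
contributes to the count, covers it. -/
theorem lt_mul_readyCount (γ N : ℕ) (hγ : 1 ≤ γ) : N < γ * readyCount γ N := by
  rw [readyCount_eq γ N hγ]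
  exact Nat.lt_mul_div_succ N hγ

section Model

variable {n : ℕ}

theorem sum_batchSize_le (M : Market n) (γ N : ℕ) (hγ : 1 ≤ γ) (i : Fin n) :
    ∑ j ∈ Finset.Icc 1 (readyCount γ N), batchSize M γ i j ≤ M.initial i + N := by
  have h : ∀ k, ∑ j ∈ Finset.Icc 1 (k + 1), batchSize M γ i j = M.initial i + γ * k := by
    intro k
    induction k with
    | zero => simp [batchSize]
    | succ k ih =>
      rw [Finset.sum_Icc_succ_top (by omega), ih]
      simp [batchSize]
      ring
  rw [readyCount_eq γ N hγ, h]
  exact Nat.add_le_add_left (Nat.mul_div_le N γ) _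

/-! ### Histories, arrivals and sales logs -/

/-- Written in forward time, the total shock is visibly monotone along a history and depends only on
the arrivals up to the current period. -/
theorem sum_seenArrivals (adv : Adversary n) (f : Arrival n → ℕ) (h : History n) :
    ((seenArrivals adv h).map f).sum =
      ∑ s ∈ Finset.range (h.length + 1), f (adv (firstEntries h s)) := by
  induction h with
  | nil => simp [seenArrivals, pastArrivals, firstEntries]
  | cons o h ih =>
    have h1 : seenArrivals adv (o :: h) = adv (o :: h) :: seenArrivals adv h := rfl
    rw [h1, List.map_cons, List.sum_cons, ih, List.length_cons, Finset.sum_range_succ _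
      (h.length + 1)]
    have h2 : firstEntries (o :: h) (h.length + 1) = o :: h := firstEntries_length (o :: h)
    rw [h2, add_comm]
    congr 1
    refine Finset.sum_congr rfl fun s hs => ?_
    rw [firstEntries_cons o h (by simpa [Nat.lt_succ_iff] using hs)]

theorem length_pastArrivals (adv : Adversary n) (h : History n) :
    (pastArrivals adv h).length = h.length := by
  induction h with
  | nil => rfl
  | cons o h ih => simp [pastArrivals, ih]

theorem valid_of_mem_seenArrivals {M : Market n} {adv : Adversary n}
    (hv : ∀ h, (adv h).IsValid M) (h : History n) : ∀ b ∈ seenArrivals adv h, b.IsValid M := by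
  induction h with
  | nil => simp [seenArrivals, pastArrivals, hv]
  | cons o h ih =>
    intro b hb
    rcases List.mem_cons.1 hb with rfl | hb
    · exact hv _
    · exact ih b hb

theorem Reachable.mem_of_choiceAt {π : Policy n} {h : History n} (hr : Reachable π h) {t : ℕ}
    (ht : t < h.length) {i : Fin n} (hi : choiceAt h t = some i) : i ∈ π (firstEntries h t) := by
  induction h with
  | nil => simp at ht
  | cons o h ih =>
    have ht' : t ≤ h.length := by simpa [Nat.lt_succ_iff] using ht
    rw [firstEntries_cons o h ht']
    rcases Nat.lt_or_eq_of_le ht' with h1 | rfl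
    · rw [choiceAt_cons o h h1] at hi
      exact ih hr.1 h1 hi
    · rw [choiceAt_cons_length] at hi
      rw [firstEntries_length]
      exact hr.2 i hi

theorem Reachable.firstEntries {π : Policy n} {h : History n} (hr : Reachable π h) {t : ℕ}
    (ht : t ≤ h.length) : Reachable π (firstEntries h t) := by
  induction h with
  | nil => simpa [_root_.firstEntries] using hr
  | cons o h ih =>
    rcases Nat.lt_or_eq_of_le ht with h1 | rfl
    · have h2 : t ≤ h.length := by simpa [Nat.lt_succ_iff] using h1
      rw [firstEntries_cons o h h2]
      exact ih hr.1 h2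
    · rwa [firstEntries_length]

/-- The sales along a history with the batches that served them. -/
def salesLog (adv : Adversary n) (pick : BatchRule n) (h : History n) :
    List (Option (Fin n × ℕ)) :=
  saleLog pick (pastArrivals adv h) h

theorem salesLog_cons (adv : Adversary n) (pick : BatchRule n) (o : Option (Fin n))
    (h : History n) : salesLog adv pick (o :: h) =
      (o.map fun i => (i, pick (seenArrivals adv h) h i)) :: salesLog adv pick h := rfl

theorem length_salesLog (adv : Adversary n) (pick : BatchRule n) (h : History n) :
    (salesLog adv pick h).length = h.length := by
  induction h with
  | nil => rfl
  | cons o h ih => rw [salesLog_cons, List.length_cons, ih, List.length_cons]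

theorem firstEntries_salesLog (adv : Adversary n) (pick : BatchRule n) (h : History n) {t : ℕ}
    (ht : t ≤ h.length) :
    firstEntries (salesLog adv pick h) t = salesLog adv pick (firstEntries h t) := by
  induction h with
  | nil => simp [salesLog, saleLog, firstEntries, pastArrivals]
  | cons o h ih =>
    rcases Nat.lt_or_eq_of_le ht with h1 | rfl
    · have h2 : t ≤ h.length := by simpa [Nat.lt_succ_iff] using h1
      rw [salesLog_cons, firstEntries_cons _ _ (by rwa [length_salesLog]), ih h2,
        firstEntries_cons o h h2]
    · conv_lhs => rw [← length_salesLog adv pick (o :: h)]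
      rw [firstEntries_length, firstEntries_length]

theorem choiceAt_salesLog (adv : Adversary n) (pick : BatchRule n) (h : History n) {t : ℕ}
    (ht : t < h.length) :
    choiceAt (salesLog adv pick h) t = (choiceAt h t).map fun i =>
      (i, pick (seenArrivals adv (firstEntries h t)) (firstEntries h t) i) := by
  induction h with
  | nil => simp at ht
  | cons o h ih =>
    have ht' : t ≤ h.length := by simpa [Nat.lt_succ_iff] using ht
    rw [salesLog_cons, firstEntries_cons o h ht']
    rcases Nat.lt_or_eq_of_le ht' with h1 | rfl
    · rw [choiceAt_cons _ _ (by rwa [length_salesLog]), choiceAt_cons _ _ h1, ih h1]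
    · conv_lhs => rw [← length_salesLog adv pick h]
      rw [choiceAt_cons_length, choiceAt_cons_length, firstEntries_length]

/-- The normalized inventory level of a fullest ready batch of product `i`. -/
noncomputable def fullestLevel (M : Market n) (γ : ℕ) (adv : Adversary n) (pick : BatchRule n)
    (i : Fin n) (h : History n) : ℝ :=
  (readyBatches γ (seenArrivals adv h) i).sup' (readyBatches_nonempty γ (seenArrivals adv h) i)
    (level M γ (salesLog adv pick h) i)

theorem level_eq_active (M : Market n) (γ : ℕ) (adv : Adversary n) (pick : BatchRule n)
    (i : Fin n) (j : ℕ) (h : History n) {t : ℕ} (ht : t ≤ h.length) :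
    level M γ (salesLog adv pick (firstEntries h t)) i j =
      1 - (active (M.duration i) (timesOf (salesLog adv pick h) (i, j)) t : ℝ) /
        batchSize M γ i j := by
  rw [level, ← firstEntries_salesLog adv pick h ht, count_take_eq_active _ _ _ _
    (M.duration_pos i) (by rwa [length_salesLog])]

/-! ### Runs of the algorithm: admissibility and payment -/

/-- The oracle never offers a product with reward zero. -/
theorem IsOracleOutput.pos {M : Market n} {a : Arrival n} (ha : a.IsValid M) {R : Fin n → ℝ}
    (hR : ∀ i, 0 ≤ R i) {S : Finset (Fin n)} (hS : IsOracleOutput M a.choice R S) {i : Fin n}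
    (hi : i ∈ S) : 0 < R i := by
  refine (hR i).lt_of_ne fun h0 => ?_
  have hf : S.erase i ∈ M.feasible := M.down_closed S hS.1 _ (Finset.erase_subset i S)
  -- Removing a product of reward zero loses nothing, and by weak substitutability the others sell
  -- at least as well. The smaller set would then be an optimum of smaller cardinality.
  have hle : ∑ k, R k * a.choice S k ≤ ∑ k, R k * a.choice (S.erase i) k := by
    refine Finset.sum_le_sum fun k _ => ?_
    rcases eq_or_ne i k with rfl | hk
    · simp [← h0]
    · refine mul_le_mul_of_nonneg_left ?_ (hR k)
      have := ha.weak_substitutability (S.erase i) hf k i hk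
      rw [Finset.insert_erase hi] at this
      exact this hS.1
  have := hS.2.2 _ hf (le_antisymm (hS.2.1 _ hf) hle)
  exact absurd this (not_le.2 (Finset.card_erase_lt_of_mem hi))

/-- The policy `π` and the batch rule `pick` form a run of the algorithm against `adv`. -/
structure IsBIBRun (M : Market n) (Ψ : ℝ → ℝ) (γ : ℕ) (adv : Adversary n) (pick : BatchRule n)
    (π : Policy n) : Prop where
  valid : ∀ h, (adv h).IsValid M
  oracle : ∀ h, IsOracleOutput M (adv h).choice
    (fun i => M.price i * Ψ (fullestLevel M γ adv pick i h)) (π h)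
  pick_mem : ∀ h, ∀ i ∈ π h, pick (seenArrivals adv h) h i ∈ readyBatches γ (seenArrivals adv h) i
  level_pick : ∀ h, ∀ i ∈ π h,
    level M γ (salesLog adv pick h) i (pick (seenArrivals adv h) h i) =
      fullestLevel M γ adv pick i h

theorem OnlineAlgorithm.IsBIB.exists_run {M : Market n} {Ψ : ℝ → ℝ} {γ : ℕ}
    {A : OnlineAlgorithm n} (hA : A.IsBIB M Ψ γ) :
    ∃ pick : BatchRule n, ∀ adv : Adversary n, (∀ h, (adv h).IsValid M) →
      IsBIBRun M Ψ γ adv pick (A.run adv) := by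
  obtain ⟨pick, hp⟩ := hA
  refine ⟨pick, fun adv hv => ?_⟩
  have hs := fun h => hp (adv h) (pastArrivals adv h) h (valid_of_mem_seenArrivals hv h)
    (length_pastArrivals adv h)
  exact ⟨hv, fun h => (hs h).1, fun h i hi => ((hs h).2 i hi).1, fun h i hi =>
    le_antisymm (Finset.le_sup' _ ((hs h).2 i hi).1) (Finset.sup'_le _ _ ((hs h).2 i hi).2)⟩

section Run

variable {M : Market n} {Ψ : ℝ → ℝ} {γ : ℕ} {adv : Adversary n} {pick : BatchRule n}
  {π : Policy n}

theorem level_le_one (M : Market n) (γ : ℕ) (log : List (Option (Fin n × ℕ))) (i : Fin n)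
    (j : ℕ) : level M γ log i j ≤ 1 := by
  have : 0 ≤ ((log.take (M.duration i - 1)).count (some (i, j)) : ℝ) / (batchSize M γ i j : ℝ) := by
    positivity
  rw [level]
  linarith

theorem batchSize_pos (hγ : 1 ≤ γ) (hinit : ∀ i, γ ≤ M.initial i) (i : Fin n) (j : ℕ) :
    0 < batchSize M γ i j := by
  have := hinit i
  rw [batchSize]
  split_ifs <;> omega

theorem level_nonneg_iff (hγ : 1 ≤ γ) (hinit : ∀ i, γ ≤ M.initial i)
    (log : List (Option (Fin n × ℕ))) (i : Fin n) (j : ℕ) :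
    0 ≤ level M γ log i j ↔
      (log.take (M.duration i - 1)).count (some (i, j)) ≤ batchSize M γ i j := by
  have hb : (0 : ℝ) < batchSize M γ i j := by exact_mod_cast batchSize_pos hγ hinit i j
  rw [level, sub_nonneg, div_le_one hb, Nat.cast_le]

theorem level_pos_iff (hγ : 1 ≤ γ) (hinit : ∀ i, γ ≤ M.initial i)
    (log : List (Option (Fin n × ℕ))) (i : Fin n) (j : ℕ) :
    0 < level M γ log i j ↔
      (log.take (M.duration i - 1)).count (some (i, j)) < batchSize M γ i j := by
  have hb : (0 : ℝ) < batchSize M γ i j := by exact_mod_cast batchSize_pos hγ hinit i j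
  rw [level, sub_pos, div_lt_one hb, Nat.cast_lt]

theorem fullestLevel_mem {h : History n} (hl : ∀ i j, 0 ≤ level M γ (salesLog adv pick h) i j) (i : Fin n) :
    fullestLevel M γ adv pick i h ∈ Icc (0 : ℝ) 1 := by
  obtain ⟨j, hj⟩ := readyBatches_nonempty γ (seenArrivals adv h) i
  exact ⟨(hl i j).trans (Finset.le_sup' _ hj),
    Finset.sup'_le _ _ fun j _ => level_le_one M γ _ i j⟩

/-- An offered product has a ready batch with an available unit. -/
theorem IsBIBRun.level_pos (hrun : IsBIBRun M Ψ γ adv pick π) (hmono : MonotoneOn Ψ (Icc 0 1))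
    (h0 : Ψ 0 = 0) {h : History n} (hl : ∀ i j, 0 ≤ level M γ (salesLog adv pick h) i j)
    {i : Fin n} (hi : i ∈ π h) :
    0 < level M γ (salesLog adv pick h) i (pick (seenArrivals adv h) h i) := by
  rw [hrun.level_pick h i hi]
  refine (fullestLevel_mem hl i).1.lt_of_ne fun h2 => ?_
  have := (hrun.oracle h).pos (hrun.valid h) (fun k => mul_nonneg (M.price_nonneg k)
    (h0 ▸ hmono (left_mem_Icc.2 zero_le_one) (fullestLevel_mem hl k) (fullestLevel_mem hl k).1)) hi
  simp [← h2, h0] at this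

/-- Induction along the history: a sale is taken from a batch of positive level, so one more unit in
use cannot exceed the batch size. -/
theorem IsBIBRun.level_nonneg (hrun : IsBIBRun M Ψ γ adv pick π)
    (hmono : MonotoneOn Ψ (Icc 0 1)) (h0 : Ψ 0 = 0) (hγ : 1 ≤ γ) (hinit : ∀ i, γ ≤ M.initial i)
    {h : History n} (hr : Reachable π h) (i : Fin n) (j : ℕ) :
    0 ≤ level M γ (salesLog adv pick h) i j := by
  induction h generalizing i j with
  | nil => simp [salesLog, saleLog, pastArrivals, level]
  | cons o h ih =>
    have ih' := ih hr.1
    rw [level_nonneg_iff hγ hinit, salesLog_cons]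
    have hprev := (level_nonneg_iff hγ hinit _ i j).1 (ih' i j)
    set d := M.duration i - 1 with hd
    -- A duration of 1 means that the unit is back in the next period, so nothing is in use.
    rcases d with _ | d
    · simp
    have hsub : ((salesLog adv pick h).take d).count (some (i, j)) ≤
        ((salesLog adv pick h).take (d + 1)).count (some (i, j)) :=
      (List.take_sublist_take_left (Nat.le_succ d)).count_le _
    rw [List.take_succ_cons, List.count_cons]
    split_ifs with hx
    · have hx' := eq_of_beq hx
      obtain ⟨i', rfl, hi'⟩ := Option.map_eq_some_iff.1 hx'
      obtain ⟨rfl, rfl⟩ := Prod.mk.inj hi'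
      have := (level_pos_iff hγ hinit _ _ _).1
        (hrun.level_pos hmono h0 ih' (hr.2 i' rfl))
      rw [← hd] at this
      omega
    · omega

/-- The sales of a product are the sales from its ready batches. -/
theorem IsBIBRun.timesOf_subset (hrun : IsBIBRun M Ψ γ adv pick π) (hγ : 1 ≤ γ) {h : History n}
    (hr : Reachable π h) (i : Fin n) :
    timesOf h i ⊆ (readyBatches γ (seenArrivals adv h) i).biUnion
      fun j => timesOf (salesLog adv pick h) (i, j) := by
  intro t ht
  obtain ⟨h1, h2⟩ := mem_timesOf.1 ht
  have h3 := hrun.pick_mem _ i (hr.mem_of_choiceAt h1 h2)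
  refine Finset.mem_biUnion.2 ⟨pick (seenArrivals adv (firstEntries h t)) (firstEntries h t) i,
    ?_, mem_timesOf.2 ⟨by rwa [length_salesLog], by rw [choiceAt_salesLog adv pick h h1, h2]; rfl⟩⟩
  rw [readyBatches, Finset.mem_Icc] at h3 ⊢
  refine ⟨h3.1, h3.2.trans (readyCount_mono γ hγ ?_)⟩
  rw [sum_seenArrivals, sum_seenArrivals, length_firstEntries h h1.le]
  refine le_trans (Finset.sum_le_sum fun s hs => ?_)
    (Finset.sum_le_sum_of_subset (Finset.range_mono (Nat.succ_le_succ h1.le)))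
  have hs' : s ≤ t := by simpa [Nat.lt_succ_iff] using hs
  have : firstEntries (firstEntries h t) s = firstEntries h s := by
    simp only [firstEntries, List.drop_drop, List.length_drop]
    congr 1
    omega
  rw [this]

/-- No ready batch is overdrawn and the picked one has a spare unit, so fewer units are in use than
the ready batches hold; the supply contains these batches. -/
theorem IsBIBRun.admissible (hrun : IsBIBRun M Ψ γ adv pick π) (hmono : MonotoneOn Ψ (Icc 0 1))
    (h0 : Ψ 0 = 0) (hγ : 1 ≤ γ) (hinit : ∀ i, γ ≤ M.initial i) : Admissible M adv π := by
  intro h hr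
  refine ⟨(hrun.oracle h).1, fun i hi => ?_⟩
  have hl := hrun.level_nonneg hmono h0 hγ hinit hr
  have hcount : ∀ j, ((salesLog adv pick h).take (M.duration i - 1)).count (some (i, j)) =
      active (M.duration i) (timesOf (salesLog adv pick h) (i, j)) h.length := fun j => by
    rw [← count_take_eq_active _ _ _ _ (M.duration_pos i) (length_salesLog adv pick h).ge]
    conv_rhs => rw [← length_salesLog adv pick h, firstEntries_length]
  have huse : inUse M h i = active (M.duration i) (timesOf h i) h.length := by
    rw [inUse, ← count_take_eq_active _ _ _ _ (M.duration_pos i) le_rfl, firstEntries_length]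
  calc inUse M h i ≤ ∑ j ∈ readyBatches γ (seenArrivals adv h) i,
        active (M.duration i) (timesOf (salesLog adv pick h) (i, j)) h.length :=
        huse ▸ active_le_sum _ _ _ _ (hrun.timesOf_subset hγ hr i) _
    _ < ∑ j ∈ readyBatches γ (seenArrivals adv h) i, batchSize M γ i j := by
        refine Finset.sum_lt_sum (fun j _ => ?_) ⟨_, hrun.pick_mem h i hi, ?_⟩
        · rw [← hcount]
          exact (level_nonneg_iff hγ hinit _ i j).1 (hl i j)
        · rw [← hcount]
          exact (level_pos_iff hγ hinit _ i _).1 (hrun.level_pos hmono h0 hl hi)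
    _ ≤ supply M (seenArrivals adv h) i := sum_batchSize_le M γ _ hγ i

/-- The sales of a product under an admissible policy, weighted by the complement of the penalty
values along a run of the algorithm, are paid for by the sales of the algorithm. -/
theorem IsBIBRun.payment (hrun : IsBIBRun M Ψ γ adv pick π) (hmono : MonotoneOn Ψ (Icc 0 1))
    (h0 : Ψ 0 = 0) (h1 : Ψ 1 = 1) (hγ : 1 ≤ γ) (hinit : ∀ i, γ ≤ M.initial i)
    (Γ : ℝ) (hΓ : 0 ≤ Γ) (hΓ1 : Γ ≤ 1)
    (hinitial : ∀ i k, k ≤ M.initial i →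
      Γ * ((M.initial i + γ : ℕ) : ℝ) * (1 - Ψ (1 - k / M.initial i)) ≤
        ∑ l ∈ Finset.range k, (1 - Γ * Ψ (1 - l / M.initial i)))
    (hlater : ∀ k : ℕ, k ≤ γ → Γ * γ * (1 - Ψ (1 - k / γ)) ≤
        ∑ l ∈ Finset.range k, (1 - Γ * Ψ (1 - l / γ)))
    {h : History n} (hr : Reachable π h) {a : ℕ → Arrival n}
    (ha : ∀ t < h.length, a t = adv (firstEntries h t))
    {π' : Policy n} (hπ' : Admissible M (oblivious a) π') {h' : History n}
    (hr' : Reachable π' h') (hlen : h'.length = h.length) (i : Fin n) :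
    Γ * ∑ t ∈ timesOf h' i, (1 - Ψ (fullestLevel M γ adv pick i (firstEntries h t))) ≤
      ∑ t ∈ timesOf h i, (1 - Γ * Ψ (fullestLevel M γ adv pick i (firstEntries h t))) := by
  set L : ℕ → Finset ℕ := fun j => timesOf (salesLog adv pick h) (i, j) with hL
  set m : ℕ → ℕ := fun t =>
    readyCount γ ((seenArrivals adv (firstEntries h t)).map fun b => b.shock i).sum with hm
  set g : ℕ → ℕ → ℝ := fun j k => Ψ (1 - k / batchSize M γ i j) with hg
  have hsize : ∀ j, (0 : ℝ) < batchSize M γ i j := fun j => by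
    exact_mod_cast batchSize_pos hγ hinit i j
  have hmem : ∀ j k, k ≤ batchSize M γ i j →
      (1 - (k : ℝ) / batchSize M γ i j) ∈ Icc (0 : ℝ) 1 := fun j k hk => by
    have h2 : (k : ℝ) / batchSize M γ i j ≤ 1 :=
      (div_le_one (hsize j)).2 (by exact_mod_cast hk)
    have h3 : 0 ≤ (k : ℝ) / batchSize M γ i j := by positivity
    exact ⟨by linarith, by linarith⟩
  have hle1 : ∀ y ∈ Icc (0 : ℝ) 1, Ψ y ≤ 1 := fun y hy =>
    h1 ▸ hmono hy (right_mem_Icc.2 zero_le_one) hy.2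
  have hlv : ∀ t ≤ h.length, ∀ i j, 0 ≤ level M γ (salesLog adv pick (firstEntries h t)) i j :=
    fun t ht => hrun.level_nonneg hmono h0 hγ hinit (hr.firstEntries ht)
  have hactle : ∀ j, ∀ t ≤ h.length, active (M.duration i) (L j) t ≤ batchSize M γ i j := by
    intro j t ht
    have h2 := hlv t ht i j
    rw [level_eq_active M γ adv pick i j h ht, sub_nonneg, div_le_one (hsize j)] at h2
    exact_mod_cast h2
  have hact : ∀ j t, active (M.duration i) (L j) t ≤ batchSize M γ i j := by
    intro j t
    rcases le_total t h.length with ht | ht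
    · exact hactle j t ht
    -- After the end of the history there are no further sales, so what is in use then was also in
    -- use at the end.
    · refine le_trans (Finset.card_le_card fun s hs => ?_) (hactle j h.length le_rfl)
      simp only [Finset.mem_filter] at hs ⊢
      have := (mem_timesOf.1 hs.1).1
      rw [length_salesLog] at this
      exact ⟨hs.1, this, by omega⟩
  have hU : ∀ t ∈ timesOf h' i, t < h.length := fun t ht => hlen ▸ (mem_timesOf.1 ht).1
  have hresid : ∀ t ≤ h.length,
      0 ≤ 1 - Γ * Ψ (fullestLevel M γ adv pick i (firstEntries h t)) := fun t ht => by
    have := hle1 _ (fullestLevel_mem (hlv t ht) i)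
    nlinarith
  refine (product_bound (M.duration i) (M.initial i + γ) γ ((timesOf h' i).sup m) (timesOf h' i) L
    (batchSize M γ i) m hγ Γ hΓ hΓ1 g
    (fun t => Ψ (fullestLevel M γ adv pick i (firstEntries h t)))
    ?_ ?_ ?_ hact (fun t _ => one_le_readyCount _ _) (fun t ht => Finset.le_sup ht)
    ?_ ?_).trans ?_
  · intro j k l hkl hl
    refine hmono (hmem j l hl) (hmem j k (hkl.trans hl)) ?_
    have := hsize j
    gcongr
  · exact fun j k hk => hle1 _ (hmem j k hk)
  · intro j k hk
    by_cases hj : j = 1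
    · have hb : batchSize M γ i j = M.initial i := by rw [batchSize, if_pos hj]
      simp only [hg, hb, if_pos hj]
      exact hinitial i k (hb ▸ hk)
    · have hb : batchSize M γ i j = γ := by rw [batchSize, if_neg hj]
      simp only [hg, hb, if_neg hj]
      exact hlater k (hb ▸ hk)
  · intro t ht
    have htl := hU t ht
    have htl' : t < h'.length := hlen.symm ▸ htl
    have h2 := (hπ' _ (hr'.firstEntries htl'.le)).2 i
      (hr'.mem_of_choiceAt htl' (mem_timesOf.1 ht).2)
    rw [inUse, count_take_eq_active _ _ _ _ (M.duration_pos i) htl'.le, supply] at h2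
    have h3 : ((seenArrivals (oblivious a) (firstEntries h' t)).map fun b => b.shock i).sum =
        ((seenArrivals adv (firstEntries h t)).map fun b => b.shock i).sum := by
      rw [sum_seenArrivals, sum_seenArrivals, length_firstEntries h' htl'.le,
        length_firstEntries h htl.le]
      refine Finset.sum_congr rfl fun s hs => ?_
      have hs' : s ≤ t := by simpa [Nat.lt_succ_iff] using hs
      have h4 : firstEntries (firstEntries h t) s = firstEntries h s := by
        simp only [firstEntries, List.drop_drop, List.length_drop]
        congr 1
        omega
      rw [h4, oblivious, length_firstEntries _ (by rwa [length_firstEntries h' htl'.le]),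
        ha s (hs'.trans_lt htl)]
    rw [h3] at h2
    refine h2.trans ?_
    -- The supply is below c_i + γ m(t) = (c_i + γ) + γ (m(t) - 1): batch 1 absorbs the charging
    -- batch.
    have h5 := lt_mul_readyCount γ
      ((seenArrivals adv (firstEntries h t)).map fun b => b.shock i).sum hγ
    have h6 : γ + γ * (m t - 1) = γ * m t := by
      rw [Nat.mul_sub, mul_one]
      have := Nat.mul_le_mul_left γ (one_le_readyCount γ
        ((seenArrivals adv (firstEntries h t)).map fun b => b.shock i).sum)
      simp only [hm]
      omega
    rw [add_assoc, h6]
    exact Nat.add_lt_add_left h5 _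
  · intro t ht j hj
    have htl := hU t ht
    simp only [hg, hL]
    rw [← level_eq_active M γ adv pick i j h htl.le]
    exact hmono ⟨hlv t htl.le i j, level_le_one M γ _ i j⟩ (fullestLevel_mem (hlv t htl.le) i)
      (Finset.le_sup' (level M γ (salesLog adv pick (firstEntries h t)) i) hj)
  · have hdisj : ((Finset.Icc 1 ((timesOf h' i).sup m) : Finset ℕ) : Set ℕ).PairwiseDisjoint L := by
      intro j _ k _ hjk
      refine Finset.disjoint_left.2 fun s hs1 hs2 => hjk ?_
      have := (mem_timesOf.1 hs1).2.symm.trans (mem_timesOf.1 hs2).2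
      simpa using this
    have hLspec : ∀ j, ∀ s ∈ L j, s ∈ timesOf h i ∧
        j = pick (seenArrivals adv (firstEntries h s)) (firstEntries h s) i := fun j s hs => by
      obtain ⟨h2, h3⟩ := mem_timesOf.1 hs
      rw [length_salesLog] at h2
      rw [choiceAt_salesLog adv pick h h2] at h3
      obtain ⟨i', h4, h5⟩ := Option.map_eq_some_iff.1 h3
      obtain ⟨rfl, rfl⟩ := Prod.mk.inj h5
      exact ⟨mem_timesOf.2 ⟨h2, h4⟩, rfl⟩
    -- A sale from batch j occurs only when j is the picked, hence fullest, batch. So its level is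
    -- the fullest level, and the batches partition a subset of the sales of i.
    calc _ = ∑ j ∈ Finset.Icc 1 ((timesOf h' i).sup m), ∑ s ∈ L j,
          (1 - Γ * Ψ (fullestLevel M γ adv pick i (firstEntries h s))) := by
          refine Finset.sum_congr rfl fun j _ => Finset.sum_congr rfl fun s hs => ?_
          obtain ⟨h2, h3⟩ := hLspec j s hs
          obtain ⟨h4, h5⟩ := mem_timesOf.1 h2
          simp only [hg, hL]
          rw [← level_eq_active M γ adv pick i j h h4.le, h3,
            hrun.level_pick _ i (hr.mem_of_choiceAt h4 h5)]
      _ = ∑ s ∈ (Finset.Icc 1 ((timesOf h' i).sup m)).biUnion L,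
          (1 - Γ * Ψ (fullestLevel M γ adv pick i (firstEntries h s))) :=
          (Finset.sum_biUnion hdisj).symm
      _ ≤ _ := Finset.sum_le_sum_of_subset_of_nonneg
          (Finset.biUnion_subset.2 fun j _ s hs => (hLspec j s hs).1)
          fun s hs _ => hresid s (mem_timesOf.1 hs).1.le

end Run

/-! ### Expectations along a policy -/

/-- `F` is a supermartingale that dominates `G` at the end. Only reachable histories matter, since a
purchase of a product that is not offered has probability zero. -/
theorem expectation_le {M : Market n} {adv : Adversary n} {π : Policy n} {N : ℕ}
    (hv : ∀ h, (adv h).IsValid M) (hfeas : ∀ h, Reachable π h → π h ∈ M.feasible)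
    (F G : History n → ℝ)
    (hstep : ∀ h, Reachable π h → h.length < N →
      ∑ o, choiceProb (adv h).choice (π h) o * F (o :: h) ≤ F h)
    (hG : ∀ h, Reachable π h → h.length = N → G h ≤ F h) (k : ℕ) (h : History n)
    (hr : Reachable π h) (hk : h.length + k = N) : expectation adv π G k h ≤ F h := by
  induction k generalizing h with
  | zero => exact hG h hr hk
  | succ k ih =>
    refine le_trans (Finset.sum_le_sum fun o _ => ?_) (hstep h hr (by omega))
    rcases o with _ | i
    · refine mul_le_mul_of_nonneg_left (ih _ ⟨hr, by simp⟩ (by simp; omega)) ?_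
      have := (hv h).sum_le_one _ (hfeas h hr)
      simpa [choiceProb] using this
    · by_cases hi : i ∈ π h
      · refine mul_le_mul_of_nonneg_left (ih _ ⟨hr, ?_⟩ (by simp; omega))
          ((hv h).nonneg _ (hfeas h hr) i)
        rintro j hj
        cases hj
        exact hi
      · simp [choiceProb, (hv h).eq_zero _ (hfeas h hr) i hi]

theorem sum_choiceProb (φ : Finset (Fin n) → Fin n → ℝ) (S : Finset (Fin n)) :
    ∑ o, choiceProb φ S o = 1 := by
  simp [Fintype.sum_option, choiceProb]

/-- The expectation of a sum of weights is at most zero if this holds for every conditional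
expectation of a weight. -/
theorem expectation_le_zero {M : Market n} {adv : Adversary n} {π : Policy n} {T : ℕ}
    (hv : ∀ h, (adv h).IsValid M) (hfeas : ∀ h, Reachable π h → π h ∈ M.feasible)
    (w : Option (Fin n) → History n → ℝ) (G : History n → ℝ)
    (hstep : ∀ h, Reachable π h → h.length < T →
      ∑ o, choiceProb (adv h).choice (π h) o * w o h ≤ 0)
    (hG : ∀ h, Reachable π h → h.length = T → G h ≤ pathSum w h) :
    expectation adv π G T [] ≤ 0 := by
  have := expectation_le hv hfeas (pathSum w) G (fun h hr hl => ?_) hG T [] trivial (by simp)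
  · simpa [pathSum_nil] using this
  · simp only [pathSum_cons, mul_add, Finset.sum_add_distrib]
    rw [← Finset.sum_mul, sum_choiceProb]
    linarith [hstep h hr hl]

theorem expectation_mul_sub (adv : Adversary n) (π : Policy n) (c : ℝ) (X Y : History n → ℝ)
    (k : ℕ) (h : History n) : expectation adv π (fun h => c * X h - Y h) k h =
      c * expectation adv π X k h - expectation adv π Y k h := by
  induction k generalizing h with
  | zero => rfl
  | succ k ih =>
    simp only [expectation, ih, Finset.mul_sum, ← Finset.sum_sub_distrib]
    exact Finset.sum_congr rfl fun o _ => by ring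

theorem expectation_const (adv : Adversary n) (π : Policy n) (c : ℝ) (k : ℕ) (h : History n) :
    expectation adv π (fun _ => c) k h = c := by
  induction k generalizing h with
  | zero => rfl
  | succ k ih => simp only [expectation, ih, ← Finset.sum_mul, sum_choiceProb, one_mul]

theorem revenue_eq_pathSum (M : Market n) (h : History n) :
    revenue M h = pathSum (fun o _ => o.elim 0 M.price) h := by
  induction h with
  | nil => simp [revenue, pathSum_nil]
  | cons o h ih =>
    rw [pathSum_cons, ← ih]
    simp [revenue, add_comm]

theorem sum_choiceProb_mul (φ : Finset (Fin n) → Fin n → ℝ) (S : Finset (Fin n)) (v : Fin n → ℝ)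
    (c : ℝ) : ∑ o : Option (Fin n), choiceProb φ S o * (o.elim 0 v - c) =
      ∑ i, v i * φ S i - c := by
  simp only [mul_sub, Finset.sum_sub_distrib, ← Finset.sum_mul, sum_choiceProb, one_mul]
  simp [Fintype.sum_option, choiceProb, mul_comm]

/-! ### The comparison with the clairvoyant optimum -/

section Competitive

variable {M : Market n} {Ψ : ℝ → ℝ} {γ : ℕ} {adv : Adversary n} {pick : BatchRule n}
  {π : Policy n}

/-- The penalized price of a product. -/
noncomputable def penalizedPrice (M : Market n) (Ψ : ℝ → ℝ) (γ : ℕ) (adv : Adversary n)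
    (pick : BatchRule n) (h : History n) (i : Fin n) : ℝ :=
  M.price i * Ψ (fullestLevel M γ adv pick i h)

/-- The optimal value of the assortment oracle. -/
noncomputable def oracleValue (M : Market n) (Ψ : ℝ → ℝ) (γ : ℕ) (adv : Adversary n)
    (pick : BatchRule n) (π : Policy n) (h : History n) : ℝ :=
  ∑ i, penalizedPrice M Ψ γ adv pick h i * (adv h).choice (π h) i

/-- Along every run of the algorithm, the clairvoyant optimum is bounded by the oracle values
and the revenue that was not already accounted for by penalized prices. -/
theorem IsBIBRun.mul_expectedRevenue_le (hrun : IsBIBRun M Ψ γ adv pick π) (Γ : ℝ) (hΓ : 0 ≤ Γ)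
    {h : History n} {a : ℕ → Arrival n} (hva : ∀ t, (a t).IsValid M)
    (ha : ∀ t < h.length, a t = adv (firstEntries h t))
    {π' : Policy n} (hπ' : Admissible M (oblivious a) π')
    (hpay : ∀ h' : History n, Reachable π' h' → h'.length = h.length → ∀ i,
      Γ * ∑ t ∈ timesOf h' i, (1 - Ψ (fullestLevel M γ adv pick i (firstEntries h t))) ≤
        ∑ t ∈ timesOf h i, (1 - Γ * Ψ (fullestLevel M γ adv pick i (firstEntries h t)))) :
    Γ * expectedRevenue M (oblivious a) π' h.length ≤
      revenue M h + Γ * pathSum (fun o g => oracleValue M Ψ γ adv pick π g -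
        o.elim 0 (penalizedPrice M Ψ γ adv pick g)) h := by
  set B := revenue M h + Γ * pathSum (fun o g => oracleValue M Ψ γ adv pick π g -
        o.elim 0 (penalizedPrice M Ψ γ adv pick g)) h with hB
  -- The randomness is that of `π'` alone; `h`, and with it all penalized prices, oracle values and
  -- `B`, is constant. The penalized price at time t is read off `h`, not off the history `g` of
  -- `π'`.
  have key := expectation_le_zero (M := M) (adv := oblivious a) (π := π') (T := h.length)
    (fun g => hva _) (fun g hg => (hπ' g hg).1)
    (fun o g => Γ * (o.elim 0 (penalizedPrice M Ψ γ adv pick (firstEntries h g.length)) -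
      oracleValue M Ψ γ adv pick π (firstEntries h g.length)))
    (fun g => Γ * revenue M g - B) ?_ ?_
  · rw [expectation_mul_sub, expectation_const] at key
    rw [expectedRevenue]
    linarith
  · intro g hg hlt
    simp only [mul_left_comm _ Γ, ← Finset.mul_sum]
    refine mul_nonpos_of_nonneg_of_nonpos hΓ ?_
    rw [sum_choiceProb_mul, oblivious, ha _ hlt, sub_nonpos]
    exact (hrun.oracle (firstEntries h g.length)).2.1 _ (hπ' g hg).1
  · intro g hg hlen
    have hrev : ∀ l : History n, revenue M l = ∑ i, ∑ t ∈ timesOf l i, M.price i := fun l => by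
      rw [revenue_eq_pathSum]
      exact sum_range_elim (fun i _ => M.price i) l
    have hpen : ∀ l : History n, ∑ t ∈ Finset.range l.length, (choiceAt l t).elim 0
          (penalizedPrice M Ψ γ adv pick (firstEntries h t)) =
        ∑ i, ∑ t ∈ timesOf l i, penalizedPrice M Ψ γ adv pick (firstEntries h t) i := fun l =>
      sum_range_elim (fun i t => penalizedPrice M Ψ γ adv pick (firstEntries h t) i) l
    have hleft : pathSum (fun o q => Γ * (o.elim 0 (penalizedPrice M Ψ γ adv pick
          (firstEntries h q.length)) -
          oracleValue M Ψ γ adv pick π (firstEntries h q.length))) g =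
        Γ * ((∑ i, ∑ t ∈ timesOf g i, penalizedPrice M Ψ γ adv pick (firstEntries h t) i) -
          ∑ t ∈ Finset.range h.length, oracleValue M Ψ γ adv pick π (firstEntries h t)) := by
      rw [← hpen, pathSum, ← hlen, ← Finset.sum_sub_distrib, Finset.mul_sum]
      refine Finset.sum_congr rfl fun t ht => ?_
      rw [length_firstEntries g (Finset.mem_range.1 ht).le]
    rw [hleft, hB, pathSum, Finset.sum_sub_distrib, hpen, hrev, hrev]
    have hsum := Finset.sum_le_sum fun i (_ : i ∈ Finset.univ) =>
      mul_le_mul_of_nonneg_left (hpay g hg hlen i) (M.price_nonneg i)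
    have e1 : ∑ i, M.price i * (Γ * ∑ t ∈ timesOf g i,
          (1 - Ψ (fullestLevel M γ adv pick i (firstEntries h t)))) =
        Γ * ((∑ i, ∑ t ∈ timesOf g i, M.price i) -
          ∑ i, ∑ t ∈ timesOf g i, penalizedPrice M Ψ γ adv pick (firstEntries h t) i) := by
      simp only [← Finset.sum_sub_distrib, Finset.mul_sum, penalizedPrice]
      exact Finset.sum_congr rfl fun i _ => Finset.sum_congr rfl fun t _ => by ring
    have e2 : ∑ i, M.price i * ∑ t ∈ timesOf h i,
          (1 - Γ * Ψ (fullestLevel M γ adv pick i (firstEntries h t))) =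
        (∑ i, ∑ t ∈ timesOf h i, M.price i) -
          Γ * ∑ i, ∑ t ∈ timesOf h i, penalizedPrice M Ψ γ adv pick (firstEntries h t) i := by
      simp only [← Finset.sum_sub_distrib, Finset.mul_sum, penalizedPrice]
      exact Finset.sum_congr rfl fun i _ => Finset.sum_congr rfl fun t _ => by ring
    rw [e1, e2] at hsum
    linarith

/-- Comparison with the clairvoyant optimum of arrivals that agree with those of the run. -/
theorem IsBIBRun.mul_clairvoyantOptimum_le (hrun : IsBIBRun M Ψ γ adv pick π) (Γ : ℝ)
    (hΓ : 0 ≤ Γ) {h : History n} {a : ℕ → Arrival n} (hva : ∀ t, (a t).IsValid M)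
    (ha : ∀ t < h.length, a t = adv (firstEntries h t))
    (hpay : ∀ π' : Policy n, Admissible M (oblivious a) π' →
      ∀ h' : History n, Reachable π' h' → h'.length = h.length → ∀ i,
      Γ * ∑ t ∈ timesOf h' i, (1 - Ψ (fullestLevel M γ adv pick i (firstEntries h t))) ≤
        ∑ t ∈ timesOf h i, (1 - Γ * Ψ (fullestLevel M γ adv pick i (firstEntries h t)))) :
    Γ * clairvoyantOptimum M a h.length ≤
      revenue M h + Γ * pathSum (fun o g => oracleValue M Ψ γ adv pick π g -
        o.elim 0 (penalizedPrice M Ψ γ adv pick g)) h := by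
  obtain ⟨S, hS⟩ := M.feasible_nonempty
  rw [clairvoyantOptimum, ← smul_eq_mul, ← Real.sSup_smul_of_nonneg hΓ]
  refine csSup_le ?_ ?_
  -- Always offering the empty assortment is admissible, so the supremum is over a nonempty set and
  -- only upper bounds on its elements are needed.
  · exact Set.Nonempty.smul_set ⟨_, fun _ => ∅,
      fun _ _ => ⟨M.down_closed S hS _ (Finset.empty_subset S), by simp⟩, rfl⟩
  · rintro _ ⟨_, ⟨π', hπ', rfl⟩, rfl⟩
    exact hrun.mul_expectedRevenue_le Γ hΓ hva ha hπ' (hpay π' hπ')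

/-- The expected revenue of the algorithm is at least `Γ` times the expected clairvoyant optimum of
arrivals that agree with those of the run. -/
theorem IsBIBRun.competitive (hrun : IsBIBRun M Ψ γ adv pick π) (hmono : MonotoneOn Ψ (Icc 0 1))
    (h0 : Ψ 0 = 0) (h1 : Ψ 1 = 1) (hγ : 1 ≤ γ) (hinit : ∀ i, γ ≤ M.initial i)
    (Γ : ℝ) (hΓ : 0 ≤ Γ) (hΓ1 : Γ ≤ 1)
    (hinitial : ∀ i k, k ≤ M.initial i →
      Γ * ((M.initial i + γ : ℕ) : ℝ) * (1 - Ψ (1 - k / M.initial i)) ≤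
        ∑ l ∈ Finset.range k, (1 - Γ * Ψ (1 - l / M.initial i)))
    (hlater : ∀ k : ℕ, k ≤ γ → Γ * γ * (1 - Ψ (1 - k / γ)) ≤
        ∑ l ∈ Finset.range k, (1 - Γ * Ψ (1 - l / γ)))
    (T : ℕ) (a : History n → ℕ → Arrival n) (hva : ∀ h t, (a h t).IsValid M)
    (ha : ∀ h : History n, h.length = T → ∀ t < T, a h t = adv (firstEntries h t)) :
    Γ * expectation adv π (fun h => clairvoyantOptimum M (a h) T) T [] ≤
      expectedRevenue M adv π T := by
  rw [expectedRevenue, ← sub_nonpos, ← expectation_mul_sub]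
  refine expectation_le_zero hrun.valid (fun h _ => (hrun.oracle h).1)
    (fun o g => Γ * (oracleValue M Ψ γ adv pick π g -
        o.elim 0 (penalizedPrice M Ψ γ adv pick g))) _ ?_ ?_
  · intro h _ _
    have := sum_choiceProb_mul (adv h).choice (π h) (penalizedPrice M Ψ γ adv pick h)
      (oracleValue M Ψ γ adv pick π h)
    simp only [mul_left_comm _ Γ, ← Finset.mul_sum]
    -- The oracle value is exactly the conditional expectation of the penalized price of the
    -- algorithm's sale.
    refine mul_nonpos_of_nonneg_of_nonpos hΓ (le_of_eq ?_)
    rw [← neg_eq_zero, ← Finset.sum_neg_distrib]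
    simp only [← mul_neg, neg_sub]
    rw [this]
    exact sub_self _
  · rintro h hr rfl
    have := hrun.mul_clairvoyantOptimum_le Γ hΓ (hva h) (ha h rfl) fun π' hπ' h' hr' hlen i =>
      hrun.payment hmono h0 h1 hγ hinit Γ hΓ hΓ1 hinitial hlater hr (ha h rfl) hπ' hr' hlen i
    have e : pathSum (fun o g => Γ * (oracleValue M Ψ γ adv pick π g -
        o.elim 0 (penalizedPrice M Ψ γ adv pick g))) h = Γ * pathSum (fun o g =>
        oracleValue M Ψ γ adv pick π g - o.elim 0 (penalizedPrice M Ψ γ adv pick g)) h := by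
      simp only [pathSum, Finset.mul_sum]
    rw [e]
    linarith

end Competitive

end Model

theorem theorem1 {n : ℕ} [NeZero n] (M : Market n) (Ψ : ℝ → ℝ)
    (hmono : MonotoneOn Ψ (Icc 0 1)) (hconc : ConcaveOn ℝ (Icc 0 1) Ψ)
    (hdiff : DifferentiableOn ℝ Ψ (Icc 0 1)) (h0 : Ψ 0 = 0) (h1 : Ψ 1 = 1)
    (γ : ℕ) (hγ1 : 1 ≤ γ) (hγ : γ ≤ M.minInitial)
    (A : OnlineAlgorithm n) (hA : A.IsBIB M Ψ γ) :
    A.IsAdmissible M ∧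
    A.IsCompetitive M (min (Gamma₁ Ψ γ M.minInitial) (Gamma₂ Ψ γ)) ∧
    A.IsAdaptivelyCompetitive M (min (Gamma₁ Ψ γ M.minInitial) (Gamma₂ Ψ γ)) := by
  have hinit : ∀ i, M.minInitial ≤ M.initial i := fun i => Finset.inf'_le _ (Finset.mem_univ i)
  have hinitγ : ∀ i, γ ≤ M.initial i := fun i => hγ.trans (hinit i)
  have hc₀ : 1 ≤ M.minInitial := hγ1.trans hγ
  obtain ⟨pick, hrun⟩ := hA.exists_run
  obtain ⟨p1, q1, r1⟩ := sInf_ratio Ψ hmono h0 h1 γ M.minInitial (Nat.cast_nonneg γ)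
    (by exact_mod_cast hc₀) (Gamma₁ Ψ γ M.minInitial) rfl
  -- `Gamma₂` is the same expression with batch size γ and no additional units, e = 0: later batches
  -- carry only their own units.
  obtain ⟨p2, -, r2⟩ := sInf_ratio Ψ hmono h0 h1 0 γ le_rfl (by exact_mod_cast hγ1)
    (Gamma₂ Ψ γ) (by simp only [Gamma₂, zero_div, add_zero, one_mul, add_sub_assoc])
  set Γ := min (Gamma₁ Ψ γ M.minInitial) (Gamma₂ Ψ γ) with hΓdef
  have hinitial : ∀ i k, k ≤ M.initial i →
      Γ * ((M.initial i + γ : ℕ) : ℝ) * (1 - Ψ (1 - k / M.initial i)) ≤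
        ∑ l ∈ Finset.range k, (1 - Γ * Ψ (1 - l / M.initial i)) := fun i k hk =>
    batch_ratio Ψ hmono hconc h1 Γ γ M.minInitial (M.initial i) (le_min p1 p2) hc₀ (hinit i)
      (r1 Γ (min_le_left _ _)) k hk
  have hlater : ∀ k : ℕ, k ≤ γ → Γ * γ * (1 - Ψ (1 - k / γ)) ≤
      ∑ l ∈ Finset.range k, (1 - Γ * Ψ (1 - l / γ)) := fun k hk => by
    have := batch_ratio Ψ hmono hconc h1 Γ 0 γ γ (le_min p1 p2) hγ1 le_rfl
      (by simpa only [Nat.cast_zero] using r2 Γ (min_le_right _ _)) k hk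
    simpa only [add_zero] using this
  -- The compared sequence may depend on the final history. The adaptive claim takes the realized
  -- sequence, the oblivious one a constant family, for which the expectation of the optimum is the
  -- optimum.
  have hcomp : ∀ adv : Adversary n, (∀ h, (adv h).IsValid M) → ∀ T (a : History n → ℕ → Arrival n),
      (∀ h t, (a h t).IsValid M) →
      (∀ h : History n, h.length = T → ∀ t < T, a h t = adv (firstEntries h t)) →
      Γ * expectation adv (A.run adv) (fun h => clairvoyantOptimum M (a h) T) T [] ≤
        expectedRevenue M adv (A.run adv) T := fun adv hv T a =>
    (hrun adv hv).competitive hmono h0 h1 hγ1 hinitγ Γ (le_min p1 p2)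
      ((min_le_left _ _).trans q1) hinitial hlater T a
  refine ⟨fun adv hv => (hrun adv hv).admissible hmono h0 hγ1 hinitγ, fun T _ a hv => ?_,
    fun T _ adv hv => hcomp adv hv T _ (fun _ _ => hv _) fun _ _ _ _ => rfl⟩
  have := hcomp (oblivious a) (fun _ => hv _) T (fun _ => a) (fun _ => hv) fun h hh t ht => by
    rw [oblivious, length_firstEntries h (hh ▸ ht.le)]
  rwa [expectation_const] at this
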